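/- Let $n,m\in\mathbb N$, let $0<\lambda_1\le\dots\le\lambda_n$ and $0<\mu_1<\dots<\mu_m$, and let $\Sigma^{++}=(\sigma^{++}_{ij})\in\mathbb R^{n\times n}$, $\Sigma^{+-}=(\sigma^{+-}_{ij})\in\mathbb R^{n\times m}$, $\Sigma^{-+}=(\sigma^{-+}_{ij})\in\mathbb R^{m\times n}$, $\Sigma^{--}=(\sigma^{--}_{ij})\in\mathbb R^{m\times m}$ and $Q_0=(q_{ij})\in\mathbb R^{n\times m}$ be constant matrices. Let $\mathcal T=\{(x,\xi): 0\le\xi\le x\le 1\}$. Consider, for $K=(K_{ij})_{1\le i\le m,\,1\le j\le n}$ and $L=(L_{ij})_{1\le i,j\le m}$ on $\mathcal T$, the system $$\mu_i\partial_xK_{ij}-\lambda_j\partial_\xi K_{ij}=\sum_{k=1}^n\sigma^{++}_{kj}K_{ik}+\sum_{p=1}^m\sigma^{-+}_{pj}L_{ip}-\sum_{i\le p\le m}K_{pj}\,\omega_{ip}(x)\qquad(1\le i\le m,\ 1\le j\le n),$$ $$\mu_i\partial_xL_{ij}+\mu_j\partial_\xi L_{ij}=\sum_{k=1}^m\sigma^{--}_{kj}L_{ik}+\sum_{p=1}^n\sigma^{+-}_{pj}K_{ip}-\sum_{i\le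 p\le m}L_{pj}\,\omega_{ip}(x)\qquad(1\le i,j\le m),$$ with the boundary conditions $$K_{ij}(x,x)=-\frac{\sigma^{-+}_{ij}}{\mu_i+\lambda_j}\ \ (1\le i\le m,\ 1\le j\le n),\qquad L_{ij}(x,x)=-\frac{\sigma^{--}_{ij}}{\mu_i-\mu_j}\ \ (1\le j<i\le m),$$ $$\mu_jL_{ij}(x,0)=\sum_{k=1}^n\lambda_kK_{ik}(x,0)\,q_{kj}\ \ (1\le i,j\le m),$$ where the upper triangular matrix $\Omega=(\omega_{ij})$ is determined by $L$ through $\omega_{ij}(x)=(\mu_i-\mu_j)L_{ij}(x,x)+\sigma^{--}_{ij}$ for $i\le j$ and $\omega_{ij}=0$ for $i>j$. Then this system has a unique solution $(K,L)$ with entries in $L^\infty(\mathcal T)$. Here equations and boundary values are understood in the weak sense: $f\in L^\infty(\mathcal T)$ satisfies $a\,\partial_xf+b\,\partial_\xi f=g$ with boundary values $f(x,x)=f_d(x)$ and $f(x,0)=f_0(x)$, where $f_d,f_0\in L^\infty(0,1)$, if $$\int_{\mathcal T}\bigl(f\,(a\,\partial_x\varphi+b\,\partial_\xi\varphi)+g\,\varphi\bigr)\,dx\,d\xi=(b-a)\int_0^1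 f_d(x)\varphi(x,x)\,dx-b\int_0^1 f_0(x)\varphi(x,0)\,dx$$ for every $\varphi\in C^1(\mathbb R^2)$ with $\varphi(1,\xi)=0$ for $0\le\xi\le1$. A solution is a pair $(K,L)$ whose entries have such boundary values in $L^\infty(0,1)$ satisfying the above relations almost everywhere (for $L_{ii}$ the diagonal value only occurs with the factor $\mu_i-\mu_i=0$). -/

import Mathlib

open MeasureTheory Set

/-- The coefficients of the hyperbolic system: the speeds `lam`, `mu`, the constant coupling
matrices `Σ⁺⁺`, `Σ⁺⁻`, `Σ⁻⁺`, `Σ⁻⁻` and the boundary coupling matrix `Q₀`. -/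
structure HyperbolicData (n m : ℕ) where
  lam : Fin n → ℝ
  mu : Fin m → ℝ
  Spp : Matrix (Fin n) (Fin n) ℝ
  Spm : Matrix (Fin n) (Fin m) ℝ
  Smp : Matrix (Fin m) (Fin n) ℝ
  Smm : Matrix (Fin m) (Fin m) ℝ
  Q : Matrix (Fin n) (Fin m) ℝ

/-- The triangle `0 ≤ ξ ≤ x ≤ 1`, points being written `(x, ξ)`. -/
def triangle : Set (ℝ × ℝ) := {p | 0 ≤ p.2 ∧ p.2 ≤ p.1 ∧ p.1 ≤ 1}

/-- A function of one variable belongs to `L^∞(0,1)`. -/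
def IsLinfUnit (h : ℝ → ℝ) : Prop := MemLp h ⊤ (volume.restrict (Ioo (0 : ℝ) 1))

/-- `f` is a weak solution on the triangle of the transport equation `a ∂ₓf + b ∂_ξf = g` with
trace `fd` on the diagonal, `f(x,x) = fd x`, and trace `f0` on the lower side, `f(x,0) = f0 x`.
This is Green's formula for the vector field `(a, b) f φ`, tested against all functions `φ` of
class `C¹` that vanish on the side `x = 1`, where nothing is prescribed. On the other two sides
the flux of `(a, b)` is `b - a` (diagonal) and `-b` (lower side), per unit of length in `x`. -/
def IsWeakTransportSolution (a b : ℝ) (f g : ℝ × ℝ → ℝ) (fd f0 : ℝ → ℝ) : Prop :=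
  ∀ φ : ℝ × ℝ → ℝ, ContDiff ℝ 1 φ → (∀ ξ ∈ Icc (0 : ℝ) 1, φ (1, ξ) = 0) →
    (∫ p in triangle, (f p * fderiv ℝ φ p (a, b) + g p * φ p)) =
      (b - a) * (∫ x in Ioo (0 : ℝ) 1, fd x * φ (x, x))
        - b * (∫ x in Ioo (0 : ℝ) 1, f0 x * φ (x, 0))

namespace HyperbolicData

variable {n m : ℕ} (S : HyperbolicData n m)

/-- The upper triangular matrix `Ω(x)` built from the diagonal values `Ld i j x = L i j (x, x)`. -/
def Omega (Ld : Fin m → Fin m → ℝ → ℝ) (x : ℝ) : Matrix (Fin m) (Fin m) ℝ :=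
  Matrix.of fun i j => if i ≤ j then (S.mu i - S.mu j) * Ld i j x + S.Smm i j else 0

/-- Right-hand side of the equation for `K i j`. -/
def rhsK (K : Fin m → Fin n → ℝ × ℝ → ℝ) (L : Fin m → Fin m → ℝ × ℝ → ℝ)
    (Ω : ℝ → Matrix (Fin m) (Fin m) ℝ) (i : Fin m) (j : Fin n) (p : ℝ × ℝ) : ℝ :=
  (∑ k, S.Spp k j * K i k p) + (∑ k, S.Smp k j * L i k p)
    - ∑ k ∈ Finset.Ici i, K k j p * Ω p.1 i k

/-- Right-hand side of the equation for `L i j`. -/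
def rhsL (K : Fin m → Fin n → ℝ × ℝ → ℝ) (L : Fin m → Fin m → ℝ × ℝ → ℝ)
    (Ω : ℝ → Matrix (Fin m) (Fin m) ℝ) (i j : Fin m) (p : ℝ × ℝ) : ℝ :=
  (∑ k, S.Smm k j * L i k p) + (∑ k, S.Spm k j * K i k p)
    - ∑ k ∈ Finset.Ici i, L k j p * Ω p.1 i k

/-- `(K, L)` solves the kernel system, with `Kd`, `Ld` the traces of `K`, `L` on the diagonal and
`K0`, `L0` their traces on the lower side `ξ = 0`. (For `i = j` the diagonal is characteristic
for `L i i`; `Ld i i` then enters only multiplied by `mu i - mu i = 0`.) -/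
structure IsKernelSolutionWithTraces
    (K : Fin m → Fin n → ℝ × ℝ → ℝ) (L : Fin m → Fin m → ℝ × ℝ → ℝ)
    (Kd K0 : Fin m → Fin n → ℝ → ℝ) (Ld L0 : Fin m → Fin m → ℝ → ℝ) : Prop where
  Kd_linf : ∀ i j, IsLinfUnit (Kd i j)
  K0_linf : ∀ i j, IsLinfUnit (K0 i j)
  Ld_linf : ∀ i j, IsLinfUnit (Ld i j)
  L0_linf : ∀ i j, IsLinfUnit (L0 i j)
  eqK : ∀ i j, IsWeakTransportSolution (S.mu i) (-S.lam j) (K i j)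
    (S.rhsK K L (S.Omega Ld) i j) (Kd i j) (K0 i j)
  eqL : ∀ i j, IsWeakTransportSolution (S.mu i) (S.mu j) (L i j)
    (S.rhsL K L (S.Omega Ld) i j) (Ld i j) (L0 i j)
  diagK : ∀ i j, ∀ᵐ x ∂(volume.restrict (Ioo (0 : ℝ) 1)),
    Kd i j x = -S.Smp i j / (S.mu i + S.lam j)
  diagL : ∀ i j, j < i → ∀ᵐ x ∂(volume.restrict (Ioo (0 : ℝ) 1)),
    Ld i j x = -S.Smm i j / (S.mu i - S.mu j)
  lowerL : ∀ i j, ∀ᵐ x ∂(volume.restrict (Ioo (0 : ℝ) 1)),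
    S.mu j * L0 i j x = ∑ k, S.lam k * K0 i k x * S.Q k j

/-- `(K, L)` is a weak solution of the kernel system. -/
def IsKernelSolution (K : Fin m → Fin n → ℝ × ℝ → ℝ) (L : Fin m → Fin m → ℝ × ℝ → ℝ) : Prop :=
  ∃ (Kd K0 : Fin m → Fin n → ℝ → ℝ) (Ld L0 : Fin m → Fin m → ℝ → ℝ),
    S.IsKernelSolutionWithTraces K L Kd K0 Ld L0

end HyperbolicData

/-!
The system is triangular in the rows of `(K, L)`. In the equations of row `i` the product
`K p j * ω i p` has `p ≥ i`; for `p = i` the factor `ω i i` is the constant `σ i i`, and for `p > i`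
the factor `K p j` belongs to a lower row. So once the rows below are known, row `i` solves a linear
system in its own entries and in the diagonal traces of `L i p` with `p > i`, for which the diagonal
is an outflow side. The rows can therefore be solved one after the other, starting with the last
one (`existsUnique_of_triangular`, `HyperbolicData.existsUnique_isRowSolution`).

All equations of a row have the same speed `a = mu i > 0` in `x`, which makes `x` a time variable.
A single transport equation with bounded right-hand side is solved by integration along the
characteristics, starting from their entry points (`characteristicSolution`). Green's formula on
each characteristic, combined with Fubini's theorem in sheared coordinates, shows that this is a weak
solution and that its traces are its values on the sides
(`isWeakTransportSolution_characteristicSolution`). Weak solutions are unique, because every test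
function `ψ` supported inside the triangle is the derivative, in the direction of the
characteristics, of a function vanishing on the outflow sides
(`IsWeakTransportSolution.ae_eq_zero`). Hence every weak solution obeys the estimates of the explicit
one: if `|g| ≤ C exp (M x)` and the inflow data are bounded by `D exp (M x)`, then solution and traces
are bounded by `(D + C / (a M)) exp (M x)` (`IsWeakTransportSolution.ae_bound`).

For a row, the inflow data on the lower side of the components with positive speed in `ξ` are
combinations of the outgoing traces of the components with negative speed. Freezing the right-hand
sides, and solving first for the latter and then for the former, defines a map on tuples of functions
and diagonal traces. In the norm weighted by `exp (-M x)` its Lipschitz constant is `O(1 / M)`, so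
that it is a contraction for large `M` (`existsUnique_isSemilinearSolution`).
-/

/-! ### The triangle and its essentially bounded functions -/

lemma isClosed_triangle : IsClosed triangle := by
  have h : triangle = {p : ℝ × ℝ | 0 ≤ p.2} ∩ ({p | p.2 ≤ p.1} ∩ {p | p.1 ≤ 1}) := by
    ext p; simp [triangle]
  rw [h]
  exact (isClosed_le continuous_const continuous_snd).inter
    ((isClosed_le continuous_snd continuous_fst).inter
      (isClosed_le continuous_fst continuous_const))

lemma triangle_subset : triangle ⊆ Icc (0 : ℝ) 1 ×ˢ Icc (0 : ℝ) 1 := by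
  rintro p ⟨h1, h2, h3⟩
  exact ⟨⟨by linarith, h3⟩, ⟨h1, by linarith⟩⟩

lemma isCompact_triangle : IsCompact triangle :=
  (isCompact_Icc.prod isCompact_Icc).of_isClosed_subset isClosed_triangle triangle_subset

lemma measurableSet_triangle : MeasurableSet triangle := isClosed_triangle.measurableSet

instance isFiniteMeasure_triangle :
    IsFiniteMeasure ((volume : Measure (ℝ × ℝ)).restrict triangle) :=
  ⟨by simpa using isCompact_triangle.measure_lt_top⟩

lemma ae_triangle_interior :
    ∀ᵐ p ∂(volume : Measure (ℝ × ℝ)).restrict triangle, 0 < p.2 ∧ p.2 < p.1 ∧ p.1 < 1 := by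
  have h1 : ∀ᵐ p : ℝ × ℝ, p.1 ≠ 1 :=
    (Measure.quasiMeasurePreserving_fst (μ := (volume : Measure ℝ))
      (ν := (volume : Measure ℝ))).ae (Measure.ae_ne volume 1)
  have h2 : ∀ᵐ p : ℝ × ℝ, p.2 ≠ 0 :=
    (Measure.quasiMeasurePreserving_snd (μ := (volume : Measure ℝ))
      (ν := (volume : Measure ℝ))).ae (Measure.ae_ne volume 0)
  have h3 : ∀ᵐ p : ℝ × ℝ, p.1 - p.2 ≠ 0 :=
    (quasiMeasurePreserving_sub (volume : Measure ℝ) (volume : Measure ℝ)).ae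
      (Measure.ae_ne volume 0)
  filter_upwards [ae_restrict_of_ae h1, ae_restrict_of_ae h2, ae_restrict_of_ae h3,
    ae_restrict_mem measurableSet_triangle] with p q1 q2 q3 ⟨r1, r2, r3⟩
  exact ⟨lt_of_le_of_ne r1 (Ne.symm q2), lt_of_le_of_ne r2 fun h => q3 (by linarith),
    lt_of_le_of_ne r3 q1⟩

lemma quasiMeasurePreserving_fst_triangle :
    Measure.QuasiMeasurePreserving Prod.fst ((volume : Measure (ℝ × ℝ)).restrict triangle)
      ((volume : Measure ℝ).restrict (Ioo 0 1)) := by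
  rw [restrict_Ioo_eq_restrict_Icc]
  exact (Measure.quasiMeasurePreserving_fst (μ := (volume : Measure ℝ))
      (ν := (volume : Measure ℝ))).restrict fun p hp => (triangle_subset hp).1

lemma IsLinfUnit.comp_fst {h : ℝ → ℝ} (hh : IsLinfUnit h) :
    MemLp (fun p : ℝ × ℝ => h p.1) ⊤ (volume.restrict triangle) := by
  refine ⟨hh.1.comp_quasiMeasurePreserving quasiMeasurePreserving_fst_triangle, ?_⟩
  refine lt_of_le_of_lt ?_ hh.2
  rw [eLpNorm_exponent_top, eLpNorm_exponent_top]
  exact essSup_le_of_ae_le _ (quasiMeasurePreserving_fst_triangle.ae ae_le_eLpNormEssSup)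

lemma MeasureTheory.MemLp.exists_ae_bound {α : Type*} {mα : MeasurableSpace α} {ν : Measure α}
    {f : α → ℝ} (hf : MemLp f ⊤ ν) : ∃ C, 0 ≤ C ∧ ∀ᵐ x ∂ν, |f x| ≤ C := by
  refine ⟨(eLpNorm f ⊤ ν).toReal, ENNReal.toReal_nonneg, ?_⟩
  have h : ∀ᵐ x ∂ν, ‖f x‖ₑ ≤ eLpNorm f ⊤ ν := by
    rw [eLpNorm_exponent_top]; exact ae_le_eLpNormEssSup
  filter_upwards [h] with x hx
  rw [← Real.norm_eq_abs, ← toReal_enorm]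
  exact ENNReal.toReal_mono hf.2.ne hx

lemma Continuous.memLp_top_triangle {ψ : ℝ × ℝ → ℝ} (hψ : Continuous ψ) :
    MemLp ψ ⊤ (volume.restrict triangle) := by
  obtain ⟨C, hC⟩ := isCompact_triangle.exists_bound_of_continuousOn hψ.continuousOn
  exact memLp_top_of_bound hψ.aestronglyMeasurable C
    ((ae_restrict_iff' measurableSet_triangle).2 (Filter.Eventually.of_forall hC))

lemma Continuous.isLinfUnit {ψ : ℝ → ℝ} (hψ : Continuous ψ) : IsLinfUnit ψ := by
  obtain ⟨C, hC⟩ := isCompact_Icc.exists_bound_of_continuousOn (s := Icc (0 : ℝ) 1)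
    hψ.continuousOn
  exact memLp_top_of_bound hψ.aestronglyMeasurable C
    ((ae_restrict_iff' measurableSet_Ioo).2
      (Filter.Eventually.of_forall fun x hx => hC x (Ioo_subset_Icc_self hx)))

lemma MeasureTheory.MemLp.mul_top {α : Type*} {mα : MeasurableSpace α} {ν : Measure α}
    {f g : α → ℝ} (hf : MemLp f ⊤ ν) (hg : MemLp g ⊤ ν) : MemLp (fun x => f x * g x) ⊤ ν :=
  MemLp.mul (p := ⊤) (q := ⊤) (r := ⊤) hg hf

lemma integrable_triangle_mul {f ψ : ℝ × ℝ → ℝ} (hf : MemLp f ⊤ (volume.restrict triangle))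
    (hψ : Continuous ψ) : Integrable (fun p => f p * ψ p) (volume.restrict triangle) :=
  (hf.mul_top hψ.memLp_top_triangle).integrable le_top

lemma IsLinfUnit.integrable_mul {h ψ : ℝ → ℝ} (hh : IsLinfUnit h) (hψ : Continuous ψ) :
    Integrable (fun x => h x * ψ x) (volume.restrict (Ioo 0 1)) :=
  (MemLp.mul_top hh hψ.isLinfUnit).integrable le_top

/-! ### Elementary properties of weak solutions -/

lemma continuous_fderiv_apply {φ : ℝ × ℝ → ℝ} (hφ : ContDiff ℝ 1 φ) (v : ℝ × ℝ) :
    Continuous fun p => fderiv ℝ φ p v :=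
  (hφ.continuous_fderiv one_ne_zero).clm_apply continuous_const

namespace IsWeakTransportSolution

variable {a b : ℝ} {f g f' g' : ℝ × ℝ → ℝ} {fd f0 fd' f0' : ℝ → ℝ}

/-- All data may be changed on null sets, and the trace on a characteristic diagonal arbitrarily. -/
lemma congr (h : IsWeakTransportSolution a b f g fd f0)
    (hf : f =ᵐ[volume.restrict triangle] f') (hg : g =ᵐ[volume.restrict triangle] g')
    (hd : b - a = 0 ∨ fd =ᵐ[volume.restrict (Ioo 0 1)] fd')
    (h0 : f0 =ᵐ[volume.restrict (Ioo 0 1)] f0') :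
    IsWeakTransportSolution a b f' g' fd' f0' := by
  intro φ hφ hφ1
  have h1 := h φ hφ hφ1
  rw [integral_congr_ae (g := fun p => f' p * fderiv ℝ φ p (a, b) + g' p * φ p)
      (by filter_upwards [hf, hg] with p h1 h2; rw [h1, h2]),
    integral_congr_ae (f := fun x => f0 x * φ (x, 0)) (g := fun x => f0' x * φ (x, 0))
      (by filter_upwards [h0] with p h1; rw [h1])] at h1
  rw [h1]
  rcases hd with hd | hd
  · simp [hd]
  · rw [integral_congr_ae (f := fun x => fd x * φ (x, x)) (g := fun x => fd' x * φ (x, x))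
      (by filter_upwards [hd] with p h1; rw [h1])]

lemma sub (h : IsWeakTransportSolution a b f g fd f0)
    (h' : IsWeakTransportSolution a b f' g' fd' f0')
    (hf : MemLp f ⊤ (volume.restrict triangle)) (hg : MemLp g ⊤ (volume.restrict triangle))
    (hf' : MemLp f' ⊤ (volume.restrict triangle)) (hg' : MemLp g' ⊤ (volume.restrict triangle))
    (hd : IsLinfUnit fd) (h0 : IsLinfUnit f0) (hd' : IsLinfUnit fd') (h0' : IsLinfUnit f0') :
    IsWeakTransportSolution a b (fun p => f p - f' p) (fun p => g p - g' p)
      (fun x => fd x - fd' x) (fun x => f0 x - f0' x) := by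
  intro φ hφ hφ1
  have e := h φ hφ hφ1
  have e' := h' φ hφ hφ1
  have c := continuous_fderiv_apply hφ (a, b)
  have cd : Continuous fun x : ℝ => φ (x, x) := hφ.continuous.comp (by fun_prop)
  have c0 : Continuous fun x : ℝ => φ (x, 0) := hφ.continuous.comp (by fun_prop)
  have i1 := (integrable_triangle_mul hf c).add (integrable_triangle_mul hg hφ.continuous)
  have i2 := (integrable_triangle_mul hf' c).add (integrable_triangle_mul hg' hφ.continuous)
  have s1 := integral_sub i1 i2
  have s2 := integral_sub (hd.integrable_mul cd) (hd'.integrable_mul cd)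
  have s3 := integral_sub (h0.integrable_mul c0) (h0'.integrable_mul c0)
  simp only [Pi.add_apply] at s1
  have l1 : (∫ p in triangle, ((f p - f' p) * fderiv ℝ φ p (a, b) + (g p - g' p) * φ p)) =
      ∫ p in triangle, (f p * fderiv ℝ φ p (a, b) + g p * φ p
        - (f' p * fderiv ℝ φ p (a, b) + g' p * φ p)) := by
    congr 1; ext p; ring
  simp only [sub_mul] at s2 s3 ⊢
  simp only [sub_mul] at l1
  rw [l1, s1, s2, s3, e, e']
  ring

end IsWeakTransportSolution

/-! ### Solutions along characteristics -/

/-- The integral of `g` along the line of slope `β` through `(0, c)`, over the part of the line in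
the triangle whose first coordinate is between `0` and `x`. -/
noncomputable def characteristicIntegral (β : ℝ) (g : ℝ × ℝ → ℝ) (x c : ℝ) : ℝ :=
  ∫ t in (0 : ℝ)..x, triangle.indicator g (t, c + β * t)

/-- The value carried into the triangle by the line of slope `β` through `(0, c)`: the line enters
through the diagonal, at `x = c / (1 - β)`, if `c > 0`, and through the lower side, at
`x = -c / β`, if `c < 0`. In the triangle, `c > 0` occurs only for `β < 1`, and `c < 0` only for
`β > 0`; the line `c = 0` through the corner is negligible. -/
noncomputable def entryValue (β : ℝ) (fd f0 : ℝ → ℝ) (c : ℝ) : ℝ :=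
  if 0 < c then fd (c / (1 - β)) else f0 (-c / β)

/-- The solution of `a ∂ₓf + b ∂_ξf = g` obtained by integrating along the characteristics, which
are the lines `ξ = c + (b / a) x`, from the entry values. -/
noncomputable def characteristicSolution (a b : ℝ) (g : ℝ × ℝ → ℝ) (fd f0 : ℝ → ℝ)
    (p : ℝ × ℝ) : ℝ :=
  entryValue (b / a) fd f0 (p.2 - b / a * p.1)
    + 1 / a * characteristicIntegral (b / a) g p.1 (p.2 - b / a * p.1)

section

variable {g : ℝ × ℝ → ℝ} {C : ℝ}

lemma measurable_indicator_line (hg : Measurable g) (β c : ℝ) :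
    Measurable fun t : ℝ => triangle.indicator g (t, c + β * t) :=
  (hg.indicator measurableSet_triangle).comp (by fun_prop)

lemma intervalIntegrable_indicator_line (hg : Measurable g) (hC : ∀ p ∈ triangle, |g p| ≤ C)
    (β c x y : ℝ) :
    IntervalIntegrable (fun t : ℝ => triangle.indicator g (t, c + β * t)) volume x y := by
  refine (intervalIntegrable_const (c := max C 0)).mono_fun
    (measurable_indicator_line hg β c).aestronglyMeasurable
    (Filter.Eventually.of_forall fun t => ?_)
  by_cases h : (t, c + β * t) ∈ triangle
  · simpa [h] using (hC _ h).trans ((le_max_left C 0).trans (le_abs_self _))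
  · simp [h]

lemma measurable_characteristicIntegral (hg : Measurable g) (hC : ∀ p ∈ triangle, |g p| ≤ C)
    (β : ℝ) : Measurable (Function.uncurry (characteristicIntegral β g)) := by
  refine measurable_uncurry_of_continuous_of_measurable (fun c => ?_) fun x => ?_
  · exact intervalIntegral.continuous_primitive
      (fun x y => intervalIntegrable_indicator_line hg hC β c x y) 0
  · unfold characteristicIntegral
    simp only [intervalIntegral.intervalIntegral_eq_integral_uIoc]
    have h : Measurable (Function.uncurry fun c t : ℝ => triangle.indicator g (t, c + β * t)) :=
      (hg.indicator measurableSet_triangle).comp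
        (by fun_prop : Measurable fun q : ℝ × ℝ => (q.2, q.1 + β * q.2))
    have hm : Measurable fun c => ∫ t in uIoc 0 x, triangle.indicator g (t, c + β * t) :=
      (StronglyMeasurable.integral_prod_right h.stronglyMeasurable).measurable
    exact hm.const_smul (_ : ℝ)

lemma measurable_characteristicSolution (hg : Measurable g) (hC : ∀ p ∈ triangle, |g p| ≤ C)
    {fd f0 : ℝ → ℝ} (hd : Measurable fd) (h0 : Measurable f0) (a b : ℝ) :
    Measurable (characteristicSolution a b g fd f0) := by
  unfold characteristicSolution
  refine Measurable.add ?_ (Measurable.const_mul ?_ _)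
  · have : Measurable (entryValue (b / a) fd f0) :=
      Measurable.ite measurableSet_Ioi (hd.comp (by fun_prop)) (h0.comp (by fun_prop))
    exact this.comp (by fun_prop)
  · exact (measurable_characteristicIntegral hg hC (b / a)).comp
      (by fun_prop : Measurable fun p : ℝ × ℝ => (p.1, p.2 - b / a * p.1))

end

/-! ### Values on the sides and growth of the solution along characteristics -/

section

variable {a b : ℝ} {g : ℝ × ℝ → ℝ} {fd f0 : ℝ → ℝ}

lemma characteristicSolution_line (c x : ℝ) :
    characteristicSolution a b g fd f0 (x, c + b / a * x) =
      entryValue (b / a) fd f0 c + 1 / a * characteristicIntegral (b / a) g x c := by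
  simp [characteristicSolution]

lemma characteristicIntegral_eq_zero {β x c : ℝ} (hx : 0 ≤ x)
    (h : ∀ t, 0 < t → t < x → (t, c + β * t) ∉ triangle) :
    characteristicIntegral β g x c = 0 := by
  unfold characteristicIntegral
  rw [intervalIntegral.integral_of_le hx, integral_Ioc_eq_integral_Ioo,
    setIntegral_congr_fun (g := fun _ => (0 : ℝ)) measurableSet_Ioo]
  · simp
  · intro t ht
    simp [h t ht.1 ht.2]

lemma characteristicSolution_diagonal (ha : 0 < a) (hba : b < a) {x : ℝ} (hx : 0 < x) :
    characteristicSolution a b g fd f0 (x, x) = fd x := by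
  have hβ : b / a < 1 := (div_lt_one ha).2 hba
  have hc : 0 < x - b / a * x := by nlinarith
  simp only [characteristicSolution, entryValue, hc, if_true]
  rw [characteristicIntegral_eq_zero hx.le]
  · rw [mul_zero, add_zero]
    congr 1
    rw [div_eq_iff (by linarith)]; ring
  · rintro t h0 ht ⟨_, h, _⟩
    simp only at h
    nlinarith

lemma characteristicSolution_lower (ha : 0 < a) (hb : 0 < b) {x : ℝ} (hx : 0 < x) :
    characteristicSolution a b g fd f0 (x, 0) = f0 x := by
  have hβ : 0 < b / a := div_pos hb ha
  have hc : ¬ 0 < 0 - b / a * x := by nlinarith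
  simp only [characteristicSolution, entryValue, hc, if_false]
  rw [characteristicIntegral_eq_zero hx.le]
  · rw [mul_zero, add_zero]
    congr 1
    rw [div_eq_iff hβ.ne']; ring
  · rintro t h0 ht ⟨h, _⟩
    simp only at h
    nlinarith

/-- Exponential growth in `x` of the data with rate `M` is inherited by the solution, and the
contribution of the right-hand side carries a factor `1 / M`. -/
lemma abs_characteristicSolution_le (ha : 0 < a) {M C D : ℝ} (hM : 0 < M) (hC : 0 ≤ C)
    (hg : ∀ p ∈ triangle, |g p| ≤ C * Real.exp (M * p.1))
    (hd : ∀ x ∈ Icc (0 : ℝ) 1, |fd x| ≤ D * Real.exp (M * x))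
    (h0 : ∀ x ∈ Icc (0 : ℝ) 1, |f0 x| ≤ D * Real.exp (M * x)) {p : ℝ × ℝ} (hp : p ∈ triangle) :
    |characteristicSolution a b g fd f0 p| ≤ (D + C / (a * M)) * Real.exp (M * p.1) := by
  have hD : 0 ≤ D := by
    have := (abs_nonneg _).trans (hd 0 (by simp))
    simpa using this
  obtain ⟨x, ξ⟩ := p
  obtain ⟨p1, p2, p3⟩ := hp
  simp only at p1 p2 p3 ⊢
  have hx : 0 ≤ x := p1.trans p2
  have mono : ∀ {y}, y ≤ x → D * Real.exp (M * y) ≤ D * Real.exp (M * x) := fun h => by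
    gcongr
  have hE : |entryValue (b / a) fd f0 (ξ - b / a * x)| ≤ D * Real.exp (M * x) := by
    set β := b / a
    unfold entryValue
    split_ifs with hc
    · have hβ : 0 < 1 - β := by
        by_contra h
        nlinarith
      have h1 : (ξ - β * x) / (1 - β) ≤ x := by
        rw [div_le_iff₀ hβ]; nlinarith
      exact (hd _ ⟨(div_pos hc hβ).le, h1.trans p3⟩).trans (mono h1)
    · rcases lt_trichotomy β 0 with hβ | hβ | hβ
      -- for `β ≤ 0` this branch is reached with `ξ = β x` only, where `f0` is evaluated at `0`
      · have h1 : -(ξ - β * x) = 0 := by nlinarith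
        rw [h1, zero_div]
        exact (h0 0 (by simp)).trans (mono hx)
      · rw [hβ, div_zero]
        exact (h0 0 (by simp)).trans (mono hx)
      · have h1 : -(ξ - β * x) / β ≤ x := by
          rw [div_le_iff₀ hβ]; nlinarith
        exact (h0 _ ⟨div_nonneg (by linarith) hβ.le, h1.trans p3⟩).trans (mono h1)
  have hI : |characteristicIntegral (b / a) g x (ξ - b / a * x)| ≤
      C / M * Real.exp (M * x) := by
    have hder : ∀ t ∈ uIcc 0 x, HasDerivAt (fun t => C / M * Real.exp (M * t))
        (C * Real.exp (M * t)) t := by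
      intro t _
      have := (((hasDerivAt_id t).const_mul M).exp).const_mul (C / M)
      convert! this using 1
      simp only [id]
      field_simp
    have hcont : Continuous fun t => C * Real.exp (M * t) := by fun_prop
    have h1 := intervalIntegral.norm_integral_le_of_norm_le (μ := volume) hx
      (f := fun t => triangle.indicator g (t, ξ - b / a * x + b / a * t))
      (g := fun t => C * Real.exp (M * t))
      (Filter.Eventually.of_forall fun t _ => ?_) (hcont.intervalIntegrable _ _)
    · rw [intervalIntegral.integral_eq_sub_of_hasDerivAt hder (hcont.intervalIntegrable _ _)]
        at h1
      refine h1.trans ?_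
      have : 0 ≤ C / M := by positivity
      simp only [mul_zero, Real.exp_zero]
      linarith
    · by_cases h : (t, ξ - b / a * x + b / a * t) ∈ triangle
      · simpa [h] using hg _ h
      · simp only [h, not_false_eq_true, indicator_of_notMem, norm_zero]
        positivity
  calc |characteristicSolution a b g fd f0 (x, ξ)|
      ≤ |entryValue (b / a) fd f0 (ξ - b / a * x)|
        + |1 / a * characteristicIntegral (b / a) g x (ξ - b / a * x)| := abs_add_le _ _
    _ ≤ D * Real.exp (M * x) + 1 / a * (C / M * Real.exp (M * x)) := by
        rw [abs_mul, abs_of_pos (by positivity : 0 < 1 / a)]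
        gcongr
    _ = (D + C / (a * M)) * Real.exp (M * x) := by
        field_simp

end

/-! ### Green's formula for the solution along characteristics -/

/-- The fundamental theorem of calculus for the product of a primitive of an integrable function with
a continuously differentiable function. -/
lemma integral_primitive_mul_deriv {G ψ : ℝ → ℝ} (hG : ∀ x y, IntervalIntegrable G volume x y)
    (hψ : ContDiff ℝ 1 ψ) (r κ : ℝ) {l u : ℝ} (hl : 0 ≤ l) (hu : l ≤ u) :
    ∫ x in l..u, ((r + κ * ∫ t in (0 : ℝ)..x, G t) * deriv ψ x + κ * G x * ψ x) =
      (r + κ * ∫ t in (0 : ℝ)..u, G t) * ψ u - (r + κ * ∫ t in (0 : ℝ)..l, G t) * ψ l := by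
  have hsub : uIcc l u ⊆ uIcc 0 u := by
    rw [uIcc_of_le hu, uIcc_of_le (hl.trans hu)]; exact Icc_subset_Icc_left hl
  have hconst : AbsolutelyContinuousOnInterval (fun _ : ℝ => r) l u :=
    (contDiff_const (c := r) (n := 1)).contDiffOn.absolutelyContinuousOnInterval
  have hF : AbsolutelyContinuousOnInterval (fun x => r + κ * ∫ t in (0 : ℝ)..x, G t) l u :=
    hconst.add ((((hG 0 u).absolutelyContinuousOnInterval_intervalIntegral
      (c := 0) (by simp)).mono hsub).const_mul κ)
  have hψa : AbsolutelyContinuousOnInterval ψ l u :=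
    hψ.contDiffOn.absolutelyContinuousOnInterval
  rw [← hF.integral_deriv_mul_eq_sub hψa]
  refine intervalIntegral.integral_congr_ae ?_
  filter_upwards [(hG 0 u).ae_hasDerivAt_integral] with x hx hxm
  have h1 := ((hx (hsub (uIoc_subset_uIcc hxm)) 0 (by simp)).const_mul κ).const_add r
  rw [h1.deriv]
  ring

/-- The integral of a function over the triangle, by integration along the lines of slope `β`. -/
lemma integral_triangle_eq_integral_lines {Ψ : ℝ × ℝ → ℝ}
    (hΨ : Integrable Ψ (volume.restrict triangle)) (β : ℝ) :
    ∫ p in triangle, Ψ p = ∫ c, ∫ x, triangle.indicator Ψ (x, c + β * x) := by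
  have hsh : MeasurePreserving (fun p : ℝ × ℝ => (p.1, p.2 + β * p.1))
      (volume : Measure (ℝ × ℝ)) volume :=
    MeasurePreserving.skew_product (μa := (volume : Measure ℝ)) (μb := (volume : Measure ℝ))
      (μc := (volume : Measure ℝ)) (μd := (volume : Measure ℝ)) (f := id)
      (g := fun x ξ => ξ + β * x) (MeasurePreserving.id _) (by fun_prop)
      (Filter.Eventually.of_forall fun x => map_add_right_eq_self _ _)
  have hi : Integrable (triangle.indicator Ψ) (volume : Measure (ℝ × ℝ)) :=
    (integrable_indicator_iff measurableSet_triangle).2 hΨ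
  have hi' : Integrable (fun p : ℝ × ℝ => triangle.indicator Ψ (p.1, p.2 + β * p.1)) :=
    hsh.integrable_comp_of_integrable hi
  have e1 : ∫ p, triangle.indicator Ψ p =
      ∫ p : ℝ × ℝ, triangle.indicator Ψ (p.1, p.2 + β * p.1) := by
    conv_lhs => rw [← hsh.map_eq]
    exact integral_map hsh.measurable.aemeasurable
      (by rw [hsh.map_eq]; exact hi.aestronglyMeasurable)
  rw [← integral_indicator measurableSet_triangle, e1, Measure.volume_eq_prod,
    integral_prod_symm _ hi']

section

variable {a b : ℝ} {g : ℝ × ℝ → ℝ} {fd f0 : ℝ → ℝ} {C : ℝ}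

/-- Green's formula on one characteristic, which meets the triangle for `l ≤ x ≤ min w 1`. -/
lemma integral_characteristic (ha : 0 < a) (hg : Measurable g)
    (hC : ∀ p ∈ triangle, |g p| ≤ C) {φ : ℝ × ℝ → ℝ} (hφ : ContDiff ℝ 1 φ)
    (hφ1 : ∀ ξ ∈ Icc (0 : ℝ) 1, φ (1, ξ) = 0) {c l w : ℝ} (hl : 0 < l) (hw : l < w)
    (hsec : ∀ x, (x, c + b / a * x) ∈ triangle ↔ l ≤ x ∧ x ≤ w ∧ x ≤ 1) :
    ∫ x, triangle.indicator (fun p => characteristicSolution a b g fd f0 p * fderiv ℝ φ p (a, b)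
        + g p * φ p) (x, c + b / a * x) =
      a * (if w < 1 then characteristicSolution a b g fd f0 (w, c + b / a * w)
          * φ (w, c + b / a * w) else 0)
        - a * (if l < 1 then characteristicSolution a b g fd f0 (l, c + b / a * l)
          * φ (l, c + b / a * l) else 0) := by
  set f := characteristicSolution a b g fd f0 with hf
  set β := b / a with hβ
  have hind : ∀ Ψ : ℝ × ℝ → ℝ, (fun x => triangle.indicator Ψ (x, c + β * x)) =
      (Icc l (min w 1)).indicator fun x => Ψ (x, c + β * x) := by
    intro Ψ; ext x
    by_cases h : (x, c + β * x) ∈ triangle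
    · rw [indicator_of_mem h, indicator_of_mem]
      simpa using (hsec x).1 h
    · rw [indicator_of_notMem h, indicator_of_notMem]
      exact fun h' => h ((hsec x).2 (by simpa using h'))
  rw [hind, integral_indicator measurableSet_Icc, integral_Icc_eq_integral_Ioc]
  rcases lt_or_ge l 1 with hl1 | hl1
  swap
  · rw [Ioc_eq_empty (by simp [hl1]), if_neg (by linarith), if_neg (by linarith)]
    simp
  have hu : l ≤ min w 1 := le_min hw.le hl1.le
  rw [← intervalIntegral.integral_of_le hu]
  set ψ : ℝ → ℝ := fun x => φ (x, c + β * x) with hψ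
  have hψC : ContDiff ℝ 1 ψ := hφ.comp (by fun_prop)
  have hψd : ∀ x, fderiv ℝ φ (x, c + β * x) (a, b) = a * deriv ψ x := by
    intro x
    have h1 : HasDerivAt (fun x : ℝ => (x, c + β * x)) (1, β) x := by
      refine (hasDerivAt_id x).prodMk ?_
      simpa using ((hasDerivAt_id x).const_mul β).const_add c
    have h2 : HasDerivAt ψ (fderiv ℝ φ (x, c + β * x) (1, β)) x :=
      ((hφ.differentiable one_ne_zero _).hasFDerivAt).comp_hasDerivAt x h1
    have h3 : (a, b) = a • ((1, β) : ℝ × ℝ) := by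
      simp [hβ, mul_div_cancel₀ b ha.ne']
    rw [h2.deriv, h3, map_smul, smul_eq_mul]
  have hfl : ∀ x, f (x, c + β * x) = entryValue β fd f0 c + 1 / a *
      ∫ t in (0 : ℝ)..x, triangle.indicator g (t, c + β * t) :=
    fun x => characteristicSolution_line c x
  have hprim := integral_primitive_mul_deriv
    (fun x y => intervalIntegrable_indicator_line hg hC β c x y) hψC
    (entryValue β fd f0 c) (1 / a) hl.le hu
  simp only [← hfl] at hprim
  have e : ∫ x in l..min w 1, (f (x, c + β * x) * fderiv ℝ φ (x, c + β * x) (a, b)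
      + g (x, c + β * x) * φ (x, c + β * x)) =
      a * ∫ x in l..min w 1, (f (x, c + β * x) * deriv ψ x
        + 1 / a * triangle.indicator g (x, c + β * x) * ψ x) := by
    rw [← intervalIntegral.integral_const_mul]
    refine intervalIntegral.integral_congr fun x hx => ?_
    rw [uIcc_of_le hu] at hx
    have hm : (x, c + β * x) ∈ triangle := (hsec x).2 (by simpa using hx)
    simp only [hψd, hm, indicator_of_mem, hψ]
    field_simp
  rw [e, hprim, if_pos hl1]
  rcases lt_or_ge w 1 with hw1 | hw1
  · rw [min_eq_left hw1.le, if_pos hw1]; ring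
  · have : ψ 1 = 0 := by
      have hm : (1, c + β * 1) ∈ triangle := (hsec 1).2 ⟨hl1.le, hw1, le_rfl⟩
      exact hφ1 _ (triangle_subset hm).2
    rw [min_eq_right hw1, if_neg (by linarith), this]; ring

/-- The integral along the characteristic `ξ = c + (b / a) x` reduces to its end points on the
diagonal, at `x = c / (1 - b / a)`, and on the lower side, at `x = -c / (b / a)`, as far as these
belong to the triangle; the signs tell entry from exit. -/
lemma integral_characteristic_eq_sides (ha : 0 < a) (hb : b ≠ 0) (hg : Measurable g)
    (hC : ∀ p ∈ triangle, |g p| ≤ C) {φ : ℝ × ℝ → ℝ} (hφ : ContDiff ℝ 1 φ)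
    (hφ1 : ∀ ξ ∈ Icc (0 : ℝ) 1, φ (1, ξ) = 0) {c : ℝ} (hc : c ≠ 0) :
    ∫ x, triangle.indicator (fun p => characteristicSolution a b g fd f0 p * fderiv ℝ φ p (a, b)
        + g p * φ p) (x, c + b / a * x) =
      -(a * Real.sign (1 - b / a)) * (Ioo (0 : ℝ) 1).indicator
          (fun x => characteristicSolution a b g fd f0 (x, x) * φ (x, x)) (c / (1 - b / a))
        - a * Real.sign (b / a) * (Ioo (0 : ℝ) 1).indicator
          (fun x => characteristicSolution a b g fd f0 (x, 0) * φ (x, 0)) (c / -(b / a)) := by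
  have key := fun (l w : ℝ) (hl : 0 < l) (hw : l < w)
    (hsec : ∀ x, (x, c + b / a * x) ∈ triangle ↔ l ≤ x ∧ x ≤ w ∧ x ≤ 1) =>
    integral_characteristic (fd := fd) (f0 := f0) ha hg hC hφ hφ1 hl hw hsec
  have hβ0 : b / a ≠ 0 := div_ne_zero hb ha.ne'
  generalize characteristicSolution a b g fd f0 = f at key ⊢
  generalize b / a = β at key hβ0 ⊢
  have ind : ∀ (F : ℝ → ℝ) {x : ℝ}, 0 < x →
      (Ioo (0 : ℝ) 1).indicator F x = if x < 1 then F x else 0 := by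
    intro F x hx
    by_cases h : x < 1 <;> simp [hx, h]
  have ind0 : ∀ (F : ℝ → ℝ) {x : ℝ}, x ≤ 0 → (Ioo (0 : ℝ) 1).indicator F x = 0 := by
    intro F x hx
    simp [hx.not_gt]
  have empty : (∀ x, (x, c + β * x) ∉ triangle) → ∀ Ψ : ℝ × ℝ → ℝ,
      ∫ x, triangle.indicator Ψ (x, c + β * x) = 0 := by
    intro h Ψ
    simp [h]
  have pd : 1 - β ≠ 0 → c + β * (c / (1 - β)) = c / (1 - β) := by
    intro h; field_simp; ring
  have p0 : c + β * (c / -β) = 0 := by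
    field_simp; ring
  have two : ¬ (2 : ℝ) < 1 := by norm_num
  rcases lt_or_gt_of_ne hc with hc | hc
  · rcases lt_or_gt_of_ne hβ0 with hβ | hβ
    · rw [empty, ind0 _ (div_nonpos_of_nonpos_of_nonneg hc.le (by linarith)),
        ind0 _ (div_nonpos_of_nonpos_of_nonneg hc.le (by linarith))]
      · ring
      · rintro x ⟨h1, h2, h3⟩
        simp only at h1 h2 h3
        nlinarith
    · have hl : 0 < c / -β := div_pos_of_neg_of_neg hc (by linarith)
      have hlx : ∀ x, c / -β ≤ x ↔ 0 ≤ c + β * x := by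
        intro x
        rw [div_le_iff_of_neg (by linarith)]
        constructor <;> intro h <;> linarith
      rcases lt_or_ge 1 β with h1 | h1
      · have hw : 0 < c / (1 - β) := div_pos_of_neg_of_neg hc (by linarith)
        have hwx : ∀ x, x ≤ c / (1 - β) ↔ c + β * x ≤ x := by
          intro x
          rw [le_div_iff_of_neg (by linarith)]
          constructor <;> intro h <;> linarith
        have hlw : c / -β < c / (1 - β) := by
          rw [div_lt_iff_of_neg (by linarith)]
          linarith [pd (by linarith)]
        rw [key (c / -β) (c / (1 - β)) hl hlw (fun x => by rw [hlx, hwx]; rfl), ind _ hw,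
          ind _ hl, pd (by linarith), p0, Real.sign_of_neg (by linarith), Real.sign_of_pos hβ]
        ring
      -- here the line leaves through `x = 1`, so that any exit abscissa beyond `1` will do
      · rw [key (c / -β) (c / -β + 2) hl (by linarith) (fun x => ?_), ind _ hl,
          ind0 _ (div_nonpos_of_nonpos_of_nonneg hc.le (by linarith)), p0, Real.sign_of_pos hβ,
          if_neg (by linarith)]
        · ring
        · rw [hlx]
          refine ⟨fun ⟨q1, q2, q3⟩ => ⟨q1, ?_, q3⟩, fun ⟨q1, q2, q3⟩ => ⟨q1, ?_, q3⟩⟩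
          · simp only at q3; linarith
          · have := hl.le.trans ((hlx x).2 q1)
            simp only
            nlinarith
  · rcases lt_or_ge β 1 with h1 | h1
    · have hl : 0 < c / (1 - β) := div_pos hc (by linarith)
      have hlx : ∀ x, c / (1 - β) ≤ x ↔ c + β * x ≤ x := by
        intro x
        rw [div_le_iff₀ (by linarith)]
        constructor <;> intro h <;> linarith
      rcases lt_or_gt_of_ne hβ0 with hβ | hβ
      · have hw : 0 < c / -β := div_pos hc (by linarith)
        have hwx : ∀ x, x ≤ c / -β ↔ 0 ≤ c + β * x := by
          intro x
          rw [le_div_iff₀ (by linarith)]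
          constructor <;> intro h <;> linarith
        have hlw : c / (1 - β) < c / -β :=
          div_lt_div_of_pos_left hc (by linarith) (by linarith)
        rw [key (c / (1 - β)) (c / -β) hl hlw
          (fun x => by rw [hlx, hwx]; exact and_left_comm), ind _ hw,
          ind _ hl, pd (by linarith), p0, Real.sign_of_pos (by linarith), Real.sign_of_neg hβ]
        ring
      -- again the line leaves through `x = 1`
      · rw [key (c / (1 - β)) (c / (1 - β) + 2) hl (by linarith) (fun x => ?_), ind _ hl,
          ind0 _ (div_nonpos_of_nonneg_of_nonpos hc.le (by linarith)), pd (by linarith),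
          Real.sign_of_pos (by linarith : 0 < 1 - β), if_neg (by linarith)]
        · ring
        · rw [hlx]
          refine ⟨fun ⟨q1, q2, q3⟩ => ⟨q2, ?_, q3⟩, fun ⟨q1, q2, q3⟩ => ⟨?_, q1, q3⟩⟩
          · simp only at q3; linarith
          · have := hl.le.trans ((hlx x).2 q1)
            simp only
            positivity
    · rw [empty, ind0 _ (div_nonpos_of_nonneg_of_nonpos hc.le (by linarith)),
        ind0 _ (div_nonpos_of_nonneg_of_nonpos hc.le (by linarith))]
      · ring
      · rintro x ⟨q1, q2, q3⟩
        simp only at q1 q2 q3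
        nlinarith

/-- The solution along characteristics is a weak solution, with its own values on the sides as
traces. -/
lemma isWeakTransportSolution_characteristicSolution (ha : 0 < a) (hb : b ≠ 0)
    (hg : Measurable g) (hC : ∀ p ∈ triangle, |g p| ≤ C)
    (hf : MemLp (characteristicSolution a b g fd f0) ⊤ (volume.restrict triangle))
    (hd : IsLinfUnit fun x => characteristicSolution a b g fd f0 (x, x))
    (h0 : IsLinfUnit fun x => characteristicSolution a b g fd f0 (x, 0)) :
    IsWeakTransportSolution a b (characteristicSolution a b g fd f0) g
      (fun x => characteristicSolution a b g fd f0 (x, x))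
      (fun x => characteristicSolution a b g fd f0 (x, 0)) := by
  intro φ hφ hφ1
  have hgL : MemLp g ⊤ (volume.restrict triangle) :=
    memLp_top_of_bound hg.aestronglyMeasurable C
      ((ae_restrict_iff' measurableSet_triangle).2 (Filter.Eventually.of_forall hC))
  have hint : Integrable (fun p => characteristicSolution a b g fd f0 p * fderiv ℝ φ p (a, b)
      + g p * φ p) (volume.restrict triangle) :=
    (integrable_triangle_mul hf (continuous_fderiv_apply hφ (a, b))).add
      (integrable_triangle_mul hgL hφ.continuous)
  rw [integral_triangle_eq_integral_lines hint (b / a)]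
  have hae : ∀ᵐ c : ℝ, c ≠ 0 := Measure.ae_ne volume 0
  rw [integral_congr_ae (hae.mono fun c hc =>
    integral_characteristic_eq_sides ha hb hg hC hφ hφ1 hc)]
  have cd : Continuous fun x : ℝ => φ (x, x) := hφ.continuous.comp (by fun_prop)
  have c0 : Continuous fun x : ℝ => φ (x, 0) := hφ.continuous.comp (by fun_prop)
  have id' := (integrable_indicator_iff measurableSet_Ioo).2 (hd.integrable_mul cd)
  have i0 := (integrable_indicator_iff measurableSet_Ioo).2 (h0.integrable_mul c0)
  have hβ0 : b / a ≠ 0 := div_ne_zero hb ha.ne'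
  rw [integral_sub, integral_const_mul, integral_const_mul, Measure.integral_comp_div _ (1 - b / a),
    Measure.integral_comp_div _ (-(b / a)), integral_indicator measurableSet_Ioo,
    integral_indicator measurableSet_Ioo, abs_neg, smul_eq_mul, smul_eq_mul]
  · have hs : ∀ r : ℝ, Real.sign r * |r| = r := by
      intro r
      rcases lt_trichotomy r 0 with h | h | h
      · rw [Real.sign_of_neg h, abs_of_neg h]; ring
      · simp [h]
      · rw [Real.sign_of_pos h, abs_of_pos h]; ring
    have e1 : a * (Real.sign (1 - b / a) * |1 - b / a|) = a - b := by
      rw [hs]; field_simp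
    have e2 : a * (Real.sign (b / a) * |b / a|) = b := by
      rw [hs]; field_simp
    generalize (∫ x in Ioo (0 : ℝ) 1, characteristicSolution a b g fd f0 (x, x) * φ (x, x)) = D
    generalize (∫ x in Ioo (0 : ℝ) 1, characteristicSolution a b g fd f0 (x, 0) * φ (x, 0)) = Z
    linear_combination (-D) * e1 - Z * e2
  -- on a characteristic diagonal the first boundary term vanishes, as `Real.sign 0 = 0`
  · by_cases h : 1 - b / a = 0
    · simp [h]
    · exact (id'.comp_div h).const_mul _
  · exact (i0.comp_div (neg_ne_zero.2 hβ0)).const_mul _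

end

/-! ### Uniqueness of weak solutions -/

lemma hasFDerivAt_integral_translates {E : Type*} [NormedAddCommGroup E] [NormedSpace ℝ E]
    {ψ : E → ℝ} (hψ : ContDiff ℝ 1 ψ) (hc : HasCompactSupport ψ) (v : E) (S : ℝ) (p : E) :
    HasFDerivAt (fun p => ∫ s in (0 : ℝ)..S, ψ (p + s • v))
      (∫ s in (0 : ℝ)..S, fderiv ℝ ψ (p + s • v)) p := by
  have hd : Continuous (fderiv ℝ ψ) := hψ.continuous_fderiv one_ne_zero
  obtain ⟨C, hC⟩ := (hc.fderiv ℝ).exists_bound_of_continuous hd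
  refine (intervalIntegral.hasFDerivAt_integral_of_dominated_of_fderiv_le
    (F' := fun p s => fderiv ℝ ψ (p + s • v)) (bound := fun _ => C)
    (Filter.univ_mem) ?_ ?_ ?_ ?_ ?_ ?_)
  · exact Filter.Eventually.of_forall fun q =>
      (hψ.continuous.comp (by fun_prop : Continuous fun s : ℝ => q + s • v)).aestronglyMeasurable
  · exact (hψ.continuous.comp
      (by fun_prop : Continuous fun s : ℝ => p + s • v)).intervalIntegrable _ _
  · exact (hd.comp (by fun_prop : Continuous fun s : ℝ => p + s • v)).aestronglyMeasurable
  · exact Filter.Eventually.of_forall fun s _ q _ => hC _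
  · exact intervalIntegrable_const
  · refine Filter.Eventually.of_forall fun s _ q _ => ?_
    have h1 : HasFDerivAt ψ (fderiv ℝ ψ (q + s • v)) (q + s • v) :=
      (hψ.differentiable one_ne_zero _).hasFDerivAt
    have h2 : HasFDerivAt (fun q : E => q + s • v) (ContinuousLinearMap.id ℝ E) q :=
      (hasFDerivAt_id q).add_const _
    simpa using! h1.comp q h2

lemma contDiff_integral_translates {E : Type*} [NormedAddCommGroup E] [NormedSpace ℝ E]
    {ψ : E → ℝ} (hψ : ContDiff ℝ 1 ψ) (hc : HasCompactSupport ψ) (v : E) (S : ℝ) :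
    ContDiff ℝ 1 (fun p => ∫ s in (0 : ℝ)..S, ψ (p + s • v)) := by
  rw [contDiff_one_iff_fderiv]
  refine ⟨fun p => (hasFDerivAt_integral_translates hψ hc v S p).differentiableAt, ?_⟩
  have h : fderiv ℝ (fun p => ∫ s in (0 : ℝ)..S, ψ (p + s • v)) =
      fun p => ∫ s in (0 : ℝ)..S, fderiv ℝ ψ (p + s • v) :=
    funext fun p => (hasFDerivAt_integral_translates hψ hc v S p).fderiv
  rw [h]
  refine intervalIntegral.continuous_parametric_intervalIntegral_of_continuous
    (f := fun p s => fderiv ℝ ψ (p + s • v)) ?_ continuous_const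
  exact (hψ.continuous_fderiv one_ne_zero).comp (by fun_prop)

lemma fderiv_integral_translates {E : Type*} [NormedAddCommGroup E] [NormedSpace ℝ E]
    {ψ : E → ℝ} (hψ : ContDiff ℝ 1 ψ) (hc : HasCompactSupport ψ) (v : E) (S : ℝ) (p : E) :
    fderiv ℝ (fun p => ∫ s in (0 : ℝ)..S, ψ (p + s • v)) p v = ψ (p + S • v) - ψ p := by
  have hd : Continuous fun s : ℝ => fderiv ℝ ψ (p + s • v) :=
    (hψ.continuous_fderiv one_ne_zero).comp (by fun_prop)
  rw [(hasFDerivAt_integral_translates hψ hc v S p).fderiv,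
    ContinuousLinearMap.intervalIntegral_apply (hd.intervalIntegrable _ _)]
  have h : ∀ s ∈ uIcc 0 S, HasDerivAt (fun s : ℝ => ψ (p + s • v))
      (fderiv ℝ ψ (p + s • v) v) s := by
    intro s _
    have h1 : HasFDerivAt ψ (fderiv ℝ ψ (p + s • v)) (p + s • v) :=
      (hψ.differentiable one_ne_zero _).hasFDerivAt
    have h2 : HasDerivAt (fun s : ℝ => p + s • v) v s := by
      simpa using ((hasDerivAt_id s).smul_const v).const_add p
    exact h1.comp_hasDerivAt s h2
  rw [intervalIntegral.integral_eq_sub_of_hasDerivAt h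
    ((hd.clm_apply continuous_const).intervalIntegrable _ _)]
  simp

/-- A function on `(0,1)` that annihilates all continuously differentiable functions vanishing at
`1` is zero almost everywhere. -/
lemma IsLinfUnit.ae_eq_zero {h : ℝ → ℝ} (hh : IsLinfUnit h)
    (h0 : ∀ χ : ℝ → ℝ, ContDiff ℝ 1 χ → χ 1 = 0 → ∫ x in Ioo (0 : ℝ) 1, h x * χ x = 0) :
    ∀ᵐ x ∂(volume.restrict (Ioo (0 : ℝ) 1)), h x = 0 := by
  have key := isOpen_Ioo.ae_eq_zero_of_integral_contDiff_smul_eq_zero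
    (U := Ioo (0 : ℝ) 1) (f := h) (μ := volume)
    (IntegrableOn.locallyIntegrableOn (MemLp.integrable le_top hh)) ?_
  · exact (ae_restrict_iff' measurableSet_Ioo).2 key
  · intro χ hχ _ hs
    have h1 : χ 1 = 0 := image_eq_zero_of_notMem_tsupport fun h => by simpa using (hs h).2
    have := h0 χ (hχ.of_le (by exact_mod_cast le_top)) h1
    rw [← this, ← integral_indicator measurableSet_Ioo]
    congr 1; ext x
    by_cases hx : x ∈ Ioo (0 : ℝ) 1
    · simp [hx, mul_comm]
    · have : χ x = 0 := image_eq_zero_of_notMem_tsupport fun h => hx (hs h)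
      simp [hx, this]

namespace IsWeakTransportSolution

variable {a b : ℝ} {f g : ℝ × ℝ → ℝ} {fd f0 : ℝ → ℝ}

/-- A weak solution with zero right-hand side and zero inflow data vanishes: a test function `ψ`
supported inside the triangle is the derivative along `(a, b)` of minus its integral along the
forward characteristics, which vanishes on the outflow sides. -/
lemma ae_eq_zero (h : IsWeakTransportSolution a b f 0 fd f0) (ha : 0 < a)
    (hf : MemLp f ⊤ (volume.restrict triangle))
    (hd : b < a → fd =ᵐ[volume.restrict (Ioo 0 1)] 0)
    (h0 : 0 < b → f0 =ᵐ[volume.restrict (Ioo 0 1)] 0) :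
    f =ᵐ[volume.restrict triangle] 0 := by
  set U : Set (ℝ × ℝ) := {p | 0 < p.2} ∩ ({p | p.2 < p.1} ∩ {p | p.1 < 1}) with hU
  have hUo : IsOpen U := (isOpen_lt continuous_const continuous_snd).inter
    ((isOpen_lt continuous_snd continuous_fst).inter (isOpen_lt continuous_fst continuous_const))
  have hUT : U ⊆ triangle := fun p hp => ⟨hp.1.le, hp.2.1.le, hp.2.2.le⟩
  have key : ∀ᵐ p, p ∈ U → f p = 0 := by
    refine hUo.ae_eq_zero_of_integral_contDiff_smul_eq_zero
      (IntegrableOn.locallyIntegrableOn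
        (IntegrableOn.mono_set (MemLp.integrable le_top hf) hUT)) fun ψ hψ hc hs => ?_
    have hψ1 : ContDiff ℝ 1 ψ := hψ.of_le (by exact_mod_cast le_top)
    have hψ0 : ∀ p, p ∉ U → ψ p = 0 :=
      fun p hp => image_eq_zero_of_notMem_tsupport fun h => hp (hs h)
    set φ : ℝ × ℝ → ℝ := fun p => - ∫ s in (0 : ℝ)..(1 / a), ψ (p + s • (a, b)) with hφ
    have hφC : ContDiff ℝ 1 φ := (contDiff_integral_translates hψ1 hc (a, b) (1 / a)).neg
    have hφz : ∀ p : ℝ × ℝ, (∀ s : ℝ, 0 ≤ s → p + s • (a, b) ∉ U) → φ p = 0 := by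
      intro p hp
      rw [hφ]
      simp only [neg_eq_zero]
      rw [intervalIntegral.integral_congr (g := fun _ => (0 : ℝ)), intervalIntegral.integral_zero]
      intro s hs
      rw [uIcc_of_le (by positivity)] at hs
      exact hψ0 _ (hp s hs.1)
    have hφd : ∀ p ∈ triangle, fderiv ℝ φ p (a, b) = ψ p := by
      intro p hp
      have e : fderiv ℝ φ p (a, b) = -(ψ (p + (1 / a) • (a, b)) - ψ p) := by
        rw [← fderiv_integral_translates hψ1 hc (a, b) (1 / a) p, hφ, fderiv_fun_neg]
        rfl
      -- within the time `1 / a` every characteristic has left the triangle through `x ≥ 1`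
      have : ψ (p + (1 / a) • (a, b)) = 0 := by
        apply hψ0
        intro hq
        have := hq.2.2
        simp only [mem_ofPred_eq, Prod.fst_add, Prod.smul_fst, smul_eq_mul,
          one_div, inv_mul_cancel₀ ha.ne'] at this
        linarith [(triangle_subset hp).1.1]
      rw [e, this]; ring
    have w := h φ hφC fun ξ _ => hφz _ fun s hs hq => by
      have := hq.2.2
      simp only [mem_ofPred_eq, Prod.fst_add, Prod.smul_fst, smul_eq_mul] at this
      nlinarith
    have wd : (b - a) * (∫ x in Ioo (0 : ℝ) 1, fd x * φ (x, x)) = 0 := by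
      rcases lt_or_ge b a with hba | hba
      · rw [integral_congr_ae (g := fun _ => (0 : ℝ))
          (by filter_upwards [hd hba] with x hx; simp [hx])]
        simp
      · have : ∀ x : ℝ, φ (x, x) = 0 := fun x => hφz _ fun s hs hq => by
          have := hq.2.1
          simp only [mem_ofPred_eq, Prod.fst_add, Prod.snd_add, Prod.smul_fst, Prod.smul_snd,
            smul_eq_mul] at this
          nlinarith
        simp [this]
    have w0 : b * (∫ x in Ioo (0 : ℝ) 1, f0 x * φ (x, 0)) = 0 := by
      rcases lt_or_ge 0 b with hb | hb
      · rw [integral_congr_ae (g := fun _ => (0 : ℝ))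
          (by filter_upwards [h0 hb] with x hx; simp [hx])]
        simp
      · have : ∀ x : ℝ, φ (x, 0) = 0 := fun x => hφz _ fun s hs hq => by
          have := hq.1
          simp only [mem_ofPred_eq, Prod.snd_add, Prod.smul_snd, smul_eq_mul] at this
          nlinarith
        simp [this]
    rw [wd, w0, sub_zero] at w
    rw [← w, ← integral_indicator measurableSet_triangle]
    congr 1; ext p
    by_cases hp : p ∈ triangle
    · simp [hp, hφd p hp, mul_comm]
    · simp [hp, hψ0 p fun h => hp (hUT h)]
  filter_upwards [ae_restrict_of_ae key, ae_triangle_interior] with p h1 h2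
  exact h1 h2

/-- If `f = 0` and the trace on one of the two sides vanishes, then so does the other one, unless the
diagonal is characteristic. -/
lemma traces_ae_eq_zero (h : IsWeakTransportSolution a b 0 0 fd f0) (ha : 0 < a) (hb : b ≠ 0)
    (hfd : IsLinfUnit fd) (hf0 : IsLinfUnit f0)
    (hd : b < a → fd =ᵐ[volume.restrict (Ioo 0 1)] 0)
    (h0 : 0 < b → f0 =ᵐ[volume.restrict (Ioo 0 1)] 0) :
    (a ≠ b → fd =ᵐ[volume.restrict (Ioo 0 1)] 0) ∧ f0 =ᵐ[volume.restrict (Ioo 0 1)] 0 := by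
  have w : ∀ χ : ℝ → ℝ, ContDiff ℝ 1 χ → χ 1 = 0 →
      0 = (b - a) * (∫ x in Ioo (0 : ℝ) 1, fd x * χ x)
        - b * (∫ x in Ioo (0 : ℝ) 1, f0 x * χ x) := by
    intro χ hχ h1
    have := h (fun p => χ p.1) (hχ.comp contDiff_fst) fun _ _ => h1
    simpa using this
  have z : ∀ (k : ℝ → ℝ), k =ᵐ[volume.restrict (Ioo 0 1)] 0 → ∀ χ : ℝ → ℝ,
      ∫ x in Ioo (0 : ℝ) 1, k x * χ x = 0 := by
    intro k hk χ
    rw [integral_congr_ae (g := fun _ => (0 : ℝ)) (by filter_upwards [hk] with x hx; simp [hx])]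
    simp
  rcases lt_or_gt_of_ne hb with hb | hb
  · have e := hd (by linarith)
    refine ⟨fun _ => e, hf0.ae_eq_zero fun χ hχ h1 => ?_⟩
    have := w χ hχ h1
    rw [z _ e, mul_zero, zero_sub, zero_eq_neg] at this
    exact (mul_eq_zero.1 this).resolve_left hb.ne
  · have e := h0 hb
    refine ⟨fun hab => hfd.ae_eq_zero fun χ hχ h1 => ?_, e⟩
    have := w χ hχ h1
    rw [z _ e, mul_zero, sub_zero, zero_eq_mul] at this
    exact this.resolve_left (sub_ne_zero.2 hab.symm)

end IsWeakTransportSolution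

/-! ### Existence and growth of weak solutions -/

lemma exists_measurable_representative {α : Type*} {mα : MeasurableSpace α} {ν : Measure α}
    {f w : α → ℝ} (hf : AEStronglyMeasurable f ν) (hw : Measurable w) (hw0 : ∀ x, 0 ≤ w x)
    (hfw : ∀ᵐ x ∂ν, |f x| ≤ w x) :
    ∃ f' : α → ℝ, Measurable f' ∧ (∀ x, |f' x| ≤ w x) ∧ f =ᵐ[ν] f' := by
  have hm := hf.stronglyMeasurable_mk.measurable
  refine ⟨{x | |hf.mk f x| ≤ w x}.indicator (hf.mk f),
    hm.indicator (measurableSet_le hm.abs hw), fun x => ?_, ?_⟩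
  · by_cases h : |hf.mk f x| ≤ w x
    · simp [indicator, h]
    · simpa [indicator, h] using hw0 x
  · filter_upwards [hf.ae_eq_mk, hfw] with x h1 h2
    rw [h1] at h2
    simp [indicator, h2, h1]

/-- The transport equation has a weak solution with given inflow data, growing in `x` at most at
the exponential rate `M` of the data. On a characteristic diagonal the trace is chosen to be
zero. -/
lemma exists_isWeakTransportSolution {a b : ℝ} (ha : 0 < a) (hb : b ≠ 0) {M C D : ℝ}
    (hM : 0 < M) (hC : 0 ≤ C) (hD : 0 ≤ D) {g : ℝ × ℝ → ℝ} {fd f0 : ℝ → ℝ}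
    (hg : MemLp g ⊤ (volume.restrict triangle)) (hd : IsLinfUnit fd) (h0 : IsLinfUnit f0)
    (hgC : ∀ᵐ p ∂volume.restrict triangle, |g p| ≤ C * Real.exp (M * p.1))
    (hdD : b < a → ∀ᵐ x ∂volume.restrict (Ioo (0 : ℝ) 1), |fd x| ≤ D * Real.exp (M * x))
    (h0D : 0 < b → ∀ᵐ x ∂volume.restrict (Ioo (0 : ℝ) 1), |f0 x| ≤ D * Real.exp (M * x)) :
    ∃ (f : ℝ × ℝ → ℝ) (fd' f0' : ℝ → ℝ), MemLp f ⊤ (volume.restrict triangle) ∧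
      IsLinfUnit fd' ∧ IsLinfUnit f0' ∧ IsWeakTransportSolution a b f g fd' f0' ∧
      (b < a → fd' =ᵐ[volume.restrict (Ioo 0 1)] fd) ∧
      (0 < b → f0' =ᵐ[volume.restrict (Ioo 0 1)] f0) ∧
      (b = a → fd' =ᵐ[volume.restrict (Ioo 0 1)] 0) ∧
      (∀ᵐ p ∂volume.restrict triangle, |f p| ≤ (D + C / (a * M)) * Real.exp (M * p.1)) ∧
      (∀ᵐ x ∂volume.restrict (Ioo (0 : ℝ) 1),
        |fd' x| ≤ (D + C / (a * M)) * Real.exp (M * x)) ∧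
      (∀ᵐ x ∂volume.restrict (Ioo (0 : ℝ) 1),
        |f0' x| ≤ (D + C / (a * M)) * Real.exp (M * x)) := by
  obtain ⟨g', hg'm, hg'C, hgg'⟩ := exists_measurable_representative hg.1
    (w := fun p => C * Real.exp (M * p.1)) (by fun_prop) (fun p => by positivity) hgC
  have rep : ∀ {P : Prop} {h : ℝ → ℝ}, IsLinfUnit h →
      (P → ∀ᵐ x ∂volume.restrict (Ioo (0 : ℝ) 1), |h x| ≤ D * Real.exp (M * x)) →
      ∃ h' : ℝ → ℝ, Measurable h' ∧ (∀ x, |h' x| ≤ D * Real.exp (M * x)) ∧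
        (P → h =ᵐ[volume.restrict (Ioo 0 1)] h') := by
    intro P h hh hD'
    by_cases hP : P
    · obtain ⟨h', h1, h2, h3⟩ := exists_measurable_representative hh.1
        (w := fun x => D * Real.exp (M * x)) (by fun_prop) (fun p => by positivity) (hD' hP)
      exact ⟨h', h1, h2, fun _ => h3⟩
    · exact ⟨0, measurable_const, fun x => by simp only [Pi.zero_apply, abs_zero]; positivity,
        fun h => absurd h hP⟩
  obtain ⟨fd', hd'm, hd'D, hdd'⟩ := rep hd hdD
  obtain ⟨f0', h0'm, h0'D, h00'⟩ := rep h0 h0D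
  set f := characteristicSolution a b g' fd' f0' with hf
  have bound : ∀ p ∈ triangle, |f p| ≤ (D + C / (a * M)) * Real.exp (M * p.1) := fun p hp =>
    abs_characteristicSolution_le ha hM hC (fun p _ => hg'C p) (fun x _ => hd'D x)
      (fun x _ => h0'D x) hp
  have hCb : ∀ p ∈ triangle, |g' p| ≤ C * Real.exp M := fun p hp => by
    refine (hg'C p).trans ?_
    have := (triangle_subset hp).1.2
    gcongr
    nlinarith
  have hfm : Measurable f := measurable_characteristicSolution hg'm hCb hd'm h0'm a b
  have exp_le : ∀ {x : ℝ}, x ≤ 1 → (D + C / (a * M)) * Real.exp (M * x) ≤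
      (D + C / (a * M)) * Real.exp M := fun {x} hx => by
    have : 0 ≤ C / (a * M) := by positivity
    gcongr
    nlinarith
  have hfL : MemLp f ⊤ (volume.restrict triangle) :=
    memLp_top_of_bound hfm.aestronglyMeasurable _ ((ae_restrict_iff' measurableSet_triangle).2
      (Filter.Eventually.of_forall fun p hp => (bound p hp).trans
        (exp_le (triangle_subset hp).1.2)))
  have side : ∀ s : ℝ → ℝ, Measurable s → (∀ x ∈ Ioo (0 : ℝ) 1, (x, s x) ∈ triangle) →
      IsLinfUnit (fun x => f (x, s x)) ∧ ∀ᵐ x ∂volume.restrict (Ioo (0 : ℝ) 1),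
        |f (x, s x)| ≤ (D + C / (a * M)) * Real.exp (M * x) := by
    intro s hs hsT
    refine ⟨memLp_top_of_bound (hfm.comp (by fun_prop)).aestronglyMeasurable
      ((D + C / (a * M)) * Real.exp M) ((ae_restrict_iff' measurableSet_Ioo).2
      (Filter.Eventually.of_forall fun x hx => (bound _ (hsT x hx)).trans (exp_le hx.2.le))),
      (ae_restrict_iff' measurableSet_Ioo).2
      (Filter.Eventually.of_forall fun x hx => bound _ (hsT x hx))⟩
  obtain ⟨sd, sdb⟩ := side id measurable_id fun x hx => ⟨hx.1.le, le_rfl, hx.2.le⟩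
  obtain ⟨s0, s0b⟩ := side (fun _ => 0) measurable_const fun x hx => ⟨le_rfl, hx.1.le, hx.2.le⟩
  have weak : IsWeakTransportSolution a b f g (fun x => f (x, x)) (fun x => f (x, 0)) :=
    (isWeakTransportSolution_characteristicSolution ha hb hg'm hCb hfL sd s0).congr
      (Filter.EventuallyEq.refl _ _) hgg'.symm (Or.inr (Filter.EventuallyEq.refl _ _))
      (Filter.EventuallyEq.refl _ _)
  have low : 0 < b → (fun x => f (x, 0)) =ᵐ[volume.restrict (Ioo 0 1)] f0 := fun h => by
    filter_upwards [h00' h, ae_restrict_mem measurableSet_Ioo] with x hx hx1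
    rw [hx, hf, characteristicSolution_lower ha h hx1.1]
  by_cases hab : b = a
  · refine ⟨f, 0, fun x => f (x, 0), hfL, MemLp.zero, s0, weak.congr
      (Filter.EventuallyEq.refl _ _) (Filter.EventuallyEq.refl _ _) (Or.inl (by linarith))
      (Filter.EventuallyEq.refl _ _), fun h => absurd hab h.ne, low,
      fun _ => Filter.EventuallyEq.refl _ _, (ae_restrict_iff' measurableSet_triangle).2
      (Filter.Eventually.of_forall bound), Filter.Eventually.of_forall fun x => ?_, s0b⟩
    simp only [Pi.zero_apply, abs_zero]
    positivity
  · refine ⟨f, fun x => f (x, x), fun x => f (x, 0), hfL, sd, s0, weak, fun h => ?_, low,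
      fun h => absurd h hab, (ae_restrict_iff' measurableSet_triangle).2
      (Filter.Eventually.of_forall bound), sdb, s0b⟩
    filter_upwards [hdd' h, ae_restrict_mem measurableSet_Ioo] with x hx hx1
    rw [hx, hf, characteristicSolution_diagonal ha h hx1.1]

/-- The a priori estimate: every weak solution, with its traces, satisfies the exponential growth
bound of the solution along characteristics, with which it coincides. -/
lemma IsWeakTransportSolution.ae_bound {a b : ℝ} (ha : 0 < a) (hb : b ≠ 0) {M C D : ℝ}
    (hM : 0 < M) (hC : 0 ≤ C) (hD : 0 ≤ D) {f g : ℝ × ℝ → ℝ} {fd f0 : ℝ → ℝ}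
    (h : IsWeakTransportSolution a b f g fd f0)
    (hf : MemLp f ⊤ (volume.restrict triangle))
    (hg : MemLp g ⊤ (volume.restrict triangle)) (hd : IsLinfUnit fd) (h0 : IsLinfUnit f0)
    (hdc : b = a → fd =ᵐ[volume.restrict (Ioo 0 1)] 0)
    (hgC : ∀ᵐ p ∂volume.restrict triangle, |g p| ≤ C * Real.exp (M * p.1))
    (hdD : b < a → ∀ᵐ x ∂volume.restrict (Ioo (0 : ℝ) 1), |fd x| ≤ D * Real.exp (M * x))
    (h0D : 0 < b → ∀ᵐ x ∂volume.restrict (Ioo (0 : ℝ) 1), |f0 x| ≤ D * Real.exp (M * x)) :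
    (∀ᵐ p ∂volume.restrict triangle, |f p| ≤ (D + C / (a * M)) * Real.exp (M * p.1)) ∧
      (∀ᵐ x ∂volume.restrict (Ioo (0 : ℝ) 1),
        |fd x| ≤ (D + C / (a * M)) * Real.exp (M * x)) ∧
      (∀ᵐ x ∂volume.restrict (Ioo (0 : ℝ) 1),
        |f0 x| ≤ (D + C / (a * M)) * Real.exp (M * x)) := by
  obtain ⟨f', fd', f0', hf', hd', h0', h', ed, e0, ec, bf, bd, b0⟩ :=
    exists_isWeakTransportSolution ha hb hM hC hD hg hd h0 hgC hdD h0D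
  have hs := h.sub h' hf hg hf' hg hd h0 hd' h0'
  have zd : b < a → (fun x => fd x - fd' x) =ᵐ[volume.restrict (Ioo 0 1)] 0 := fun hba => by
    filter_upwards [ed hba] with x hx
    simp [hx]
  have z0 : 0 < b → (fun x => f0 x - f0' x) =ᵐ[volume.restrict (Ioo 0 1)] 0 := fun hb0 => by
    filter_upwards [e0 hb0] with x hx
    simp [hx]
  have hs' : IsWeakTransportSolution a b (fun p => f p - f' p) 0 (fun x => fd x - fd' x)
      (fun x => f0 x - f0' x) := by
    convert hs using 1
    ext p; simp
  have zf := hs'.ae_eq_zero ha (hf.sub hf') zd z0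
  have hz := (hs'.congr zf (Filter.EventuallyEq.refl _ _)
    (Or.inr (Filter.EventuallyEq.refl _ _)) (Filter.EventuallyEq.refl _ _)).traces_ae_eq_zero ha hb
      (MemLp.sub hd hd') (MemLp.sub h0 h0') zd z0
  have zd' : (fun x => fd x - fd' x) =ᵐ[volume.restrict (Ioo 0 1)] 0 := by
    by_cases hab : b = a
    · filter_upwards [hdc hab, ec hab] with x h1 h2
      simp [h1, h2]
    · exact hz.1 (Ne.symm hab)
  refine ⟨?_, ?_, ?_⟩
  · filter_upwards [zf, bf] with p h1 h2
    rwa [sub_eq_zero.1 h1]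
  · filter_upwards [zd', bd] with p h1 h2
    rwa [sub_eq_zero.1 h1]
  · filter_upwards [hz.2, b0] with p h1 h2
    rwa [sub_eq_zero.1 h1]

/-! ### Systems with a common speed in `x` -/

/-- A family of weak solutions of `a ∂ₓf_c + b_c ∂_ξf_c = g_c` with inflow data `D` on the diagonal
and, on the lower side, incoming traces that are combinations of the other traces there. Traces on
a characteristic diagonal, which are arbitrary, are normalized to be zero. -/
structure IsCoupledSolution {ι : Type*} [Fintype ι] (a : ℝ) (b : ι → ℝ) (q : ι → ι → ℝ)
    (D : ι → ℝ → ℝ) (g f : ι → ℝ × ℝ → ℝ) (fd f0 : ι → ℝ → ℝ) : Prop where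
  memLp : ∀ c, MemLp (f c) ⊤ (volume.restrict triangle)
  diag_linf : ∀ c, IsLinfUnit (fd c)
  lower_linf : ∀ c, IsLinfUnit (f0 c)
  weak : ∀ c, IsWeakTransportSolution a (b c) (f c) (g c) (fd c) (f0 c)
  diag : ∀ c, b c < a → fd c =ᵐ[volume.restrict (Ioo 0 1)] D c
  lower : ∀ c, 0 < b c →
    f0 c =ᵐ[volume.restrict (Ioo 0 1)] fun x => ∑ c', q c c' * f0 c' x
  normalized : ∀ c, b c = a → fd c =ᵐ[volume.restrict (Ioo 0 1)] 0

lemma isLinfUnit_sum {ι : Type*} [Fintype ι] (q : ι → ℝ) {h : ι → ℝ → ℝ}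
    (hh : ∀ c, IsLinfUnit (h c)) : IsLinfUnit fun x => ∑ c, q c * h c x :=
  memLp_finsetSum _ fun c _ => (hh c).const_mul (q c)

lemma exists_isWeakTransportSolution_of_memLp {a b : ℝ} (ha : 0 < a) (hb : b ≠ 0)
    {g : ℝ × ℝ → ℝ} {fd f0 : ℝ → ℝ} (hg : MemLp g ⊤ (volume.restrict triangle))
    (hd : IsLinfUnit fd) (h0 : IsLinfUnit f0) :
    ∃ (f : ℝ × ℝ → ℝ) (fd' f0' : ℝ → ℝ), MemLp f ⊤ (volume.restrict triangle) ∧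
      IsLinfUnit fd' ∧ IsLinfUnit f0' ∧ IsWeakTransportSolution a b f g fd' f0' ∧
      (b < a → fd' =ᵐ[volume.restrict (Ioo 0 1)] fd) ∧
      (0 < b → f0' =ᵐ[volume.restrict (Ioo 0 1)] f0) ∧
      (b = a → fd' =ᵐ[volume.restrict (Ioo 0 1)] 0) := by
  obtain ⟨C, hC, hgC⟩ := hg.exists_ae_bound
  obtain ⟨Dd, hDd, hdD⟩ := MemLp.exists_ae_bound hd
  obtain ⟨D0, hD0, h0D⟩ := MemLp.exists_ae_bound h0
  have one_le : ∀ {x : ℝ}, 0 ≤ x → 1 ≤ Real.exp (1 * x) := fun hx =>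
    Real.one_le_exp (by linarith)
  have hside : ∀ {h : ℝ → ℝ} {B : ℝ}, 0 ≤ B → B ≤ max Dd D0 →
      (∀ᵐ x ∂volume.restrict (Ioo (0 : ℝ) 1), |h x| ≤ B) →
      ∀ᵐ x ∂volume.restrict (Ioo (0 : ℝ) 1), |h x| ≤ max Dd D0 * Real.exp (1 * x) := by
    intro h B hB hB' hh
    filter_upwards [hh, ae_restrict_mem measurableSet_Ioo] with x h1 h2
    nlinarith [one_le h2.1.le]
  obtain ⟨f, fd', f0', h1, h2, h3, h4, h5, h6, h7, -⟩ := exists_isWeakTransportSolution ha hb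
    one_pos hC (hDd.trans (le_max_left Dd D0)) hg hd h0 (by
      filter_upwards [hgC, ae_restrict_mem measurableSet_triangle] with p h1 h2
      nlinarith [one_le (triangle_subset h2).1.1])
    (fun _ => hside hDd (le_max_left _ _) hdD) (fun _ => hside hD0 (le_max_right _ _) h0D)
  exact ⟨f, fd', f0', h1, h2, h3, h4, h5, h6, h7⟩

section

variable {ι : Type*} [Fintype ι] {a : ℝ} {b : ι → ℝ} {q : ι → ι → ℝ} {D : ι → ℝ → ℝ}

/-- The components with `b c < 0` are found first; their traces on the lower side then provide the
inflow data of the others. -/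
lemma exists_isCoupledSolution (ha : 0 < a) (hb : ∀ c, b c ≠ 0)
    (hq : ∀ c c', q c c' ≠ 0 → b c' < 0) (hD : ∀ c, IsLinfUnit (D c)) {g : ι → ℝ × ℝ → ℝ}
    (hg : ∀ c, MemLp (g c) ⊤ (volume.restrict triangle)) :
    ∃ f fd f0, IsCoupledSolution a b q D g f fd f0 := by
  choose f₁ d₁ l₁ hf₁ hd₁ hl₁ hw₁ hD₁ _ hn₁ using fun c =>
    exists_isWeakTransportSolution_of_memLp ha (hb c) (hg c) (hD c)
      (MemLp.zero : IsLinfUnit 0)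
  have h₂ : ∀ c, ∃ (f : ℝ × ℝ → ℝ) (fd' f0' : ℝ → ℝ), MemLp f ⊤ (volume.restrict triangle) ∧
      IsLinfUnit fd' ∧ IsLinfUnit f0' ∧ IsWeakTransportSolution a (b c) f (g c) fd' f0' ∧
      (b c < a → fd' =ᵐ[volume.restrict (Ioo 0 1)] D c) ∧
      (0 < b c → f0' =ᵐ[volume.restrict (Ioo 0 1)] fun x => ∑ c', q c c' * l₁ c' x) ∧
      (b c = a → fd' =ᵐ[volume.restrict (Ioo 0 1)] 0) ∧ (b c < 0 → f0' = l₁ c) := by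
    intro c
    rcases lt_or_gt_of_ne (hb c) with h | h
    · exact ⟨f₁ c, d₁ c, l₁ c, hf₁ c, hd₁ c, hl₁ c, hw₁ c, hD₁ c, fun h' => absurd h h'.not_gt,
        hn₁ c, fun _ => rfl⟩
    · obtain ⟨f, fd', f0', h1, h2, h3, h4, h5, h6, h7⟩ :=
        exists_isWeakTransportSolution_of_memLp ha (hb c) (hg c) (hD c)
          (isLinfUnit_sum (q c) hl₁)
      exact ⟨f, fd', f0', h1, h2, h3, h4, h5, h6, h7, fun h' => absurd h h'.not_gt⟩
  choose f fd f0 hf hfd hf0 hw hdD h0 hn hl using h₂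
  refine ⟨f, fd, f0, hf, hfd, hf0, hw, hdD, fun c hc => ?_, hn⟩
  filter_upwards [h0 c hc] with x hx
  rw [hx]
  refine Finset.sum_congr rfl fun c' _ => ?_
  by_cases h : q c c' = 0
  · simp [h]
  · rw [hl c' (hq c c' h)]

/-- Two coupled solutions differ by at most a constant over `M` times the weighted difference of
their right-hand sides; the constant does not depend on `M`. -/
lemma IsCoupledSolution.ae_dist_bound (ha : 0 < a) (hb : ∀ c, b c ≠ 0)
    (hq : ∀ c c', q c c' ≠ 0 → b c' < 0) {g f g' f' : ι → ℝ × ℝ → ℝ}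
    {fd f0 fd' f0' : ι → ℝ → ℝ} (h : IsCoupledSolution a b q D g f fd f0)
    (h' : IsCoupledSolution a b q D g' f' fd' f0')
    (hg : ∀ c, MemLp (g c) ⊤ (volume.restrict triangle))
    (hg' : ∀ c, MemLp (g' c) ⊤ (volume.restrict triangle)) {M C : ℝ} (hM : 0 < M) (hC : 0 ≤ C)
    (hgC : ∀ c, ∀ᵐ p ∂volume.restrict triangle, |g c p - g' c p| ≤ C * Real.exp (M * p.1))
    (c : ι) :
    (∀ᵐ p ∂volume.restrict triangle, |f c p - f' c p| ≤
        ((1 + ∑ c, ∑ c', |q c c'|) / a * C / M) * Real.exp (M * p.1)) ∧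
      (∀ᵐ x ∂volume.restrict (Ioo (0 : ℝ) 1), |fd c x - fd' c x| ≤
        ((1 + ∑ c, ∑ c', |q c c'|) / a * C / M) * Real.exp (M * x)) := by
  set Q := ∑ c, ∑ c', |q c c'| with hQ
  have hQ0 : 0 ≤ Q := by positivity
  have hs := fun c => (h.weak c).sub (h'.weak c) (h.memLp c) (hg c) (h'.memLp c) (hg' c)
    (h.diag_linf c) (h.lower_linf c) (h'.diag_linf c) (h'.lower_linf c)
  have zd : ∀ c, b c < a → ∀ {B : ℝ}, 0 ≤ B →
      ∀ᵐ x ∂volume.restrict (Ioo (0 : ℝ) 1), |fd c x - fd' c x| ≤ B * Real.exp (M * x) := by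
    intro c hc B hB
    filter_upwards [h.diag c hc, h'.diag c hc] with x h1 h2
    rw [h1, h2, sub_self, abs_zero]
    positivity
  have zn : ∀ c, b c = a → (fun x => fd c x - fd' c x) =ᵐ[volume.restrict (Ioo 0 1)] 0 := by
    intro c hc
    filter_upwards [h.normalized c hc, h'.normalized c hc] with x h1 h2
    simp [h1, h2]
  have est := fun (c : ι) {B : ℝ} (hB : 0 ≤ B) h0 => (hs c).ae_bound ha (hb c) hM hC hB
    ((h.memLp c).sub (h'.memLp c)) ((hg c).sub (hg' c)) ((h.diag_linf c).sub (h'.diag_linf c))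
    ((h.lower_linf c).sub (h'.lower_linf c)) (zn c) (hgC c) (fun hc => zd c hc hB) h0
  have hneg : ∀ c, b c < 0 → ∀ᵐ x ∂volume.restrict (Ioo (0 : ℝ) 1),
      |f0 c x - f0' c x| ≤ C / (a * M) * Real.exp (M * x) := by
    intro c hc
    simpa using (est c le_rfl fun h => absurd hc h.not_gt).2.2
  have hlow : 0 < b c → ∀ᵐ x ∂volume.restrict (Ioo (0 : ℝ) 1),
      |f0 c x - f0' c x| ≤ Q * (C / (a * M)) * Real.exp (M * x) := by
    intro hc
    have hall : ∀ᵐ x ∂volume.restrict (Ioo (0 : ℝ) 1), ∀ c', b c' < 0 →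
        |f0 c' x - f0' c' x| ≤ C / (a * M) * Real.exp (M * x) := by
      rw [ae_all_iff]; intro c'
      by_cases hc' : b c' < 0
      · filter_upwards [hneg c' hc'] with x hx _ using hx
      · exact Filter.Eventually.of_forall fun x h => absurd h hc'
    filter_upwards [h.lower c hc, h'.lower c hc, hall] with x h1 h2 h3
    rw [h1, h2, ← Finset.sum_sub_distrib]
    have hqQ : ∑ c', |q c c'| ≤ Q :=
      Finset.single_le_sum (f := fun c => ∑ c', |q c c'|) (fun _ _ => by positivity)
        (Finset.mem_univ c)
    calc |∑ c', (q c c' * f0 c' x - q c c' * f0' c' x)|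
        ≤ ∑ c', |q c c' * f0 c' x - q c c' * f0' c' x| := Finset.abs_sum_le_sum_abs _ _
      _ ≤ ∑ c', |q c c'| * (C / (a * M) * Real.exp (M * x)) := by
          refine Finset.sum_le_sum fun c' _ => ?_
          rw [← mul_sub, abs_mul]
          by_cases hc' : q c c' = 0
          · simp [hc']
          · exact mul_le_mul_of_nonneg_left (h3 c' (hq c c' hc')) (abs_nonneg _)
      _ = (∑ c', |q c c'|) * (C / (a * M)) * Real.exp (M * x) := by
          rw [← Finset.sum_mul]; ring
      _ ≤ Q * (C / (a * M)) * Real.exp (M * x) := by gcongr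
  have hB : 0 ≤ Q * (C / (a * M)) := by positivity
  have e : (1 + Q) / a * C / M = Q * (C / (a * M)) + C / (a * M) := by field_simp; ring
  rw [e]
  exact ⟨(est c hB hlow).1, (est c hB hlow).2.1⟩

end

/-! ### Solvability of semilinear systems -/

/-- The family `f` of functions on the triangle solves the system with right-hand sides
`G c p (f p) (fd p.1)`, where `fd` are the diagonal traces of `f`. The data `D` are imposed on the
diagonal where it is an inflow side, and the incoming traces on the lower side are combinations
of the other traces there. -/
def IsSemilinearSolution {ι : Type*} [Fintype ι] (a : ℝ) (b : ι → ℝ) (q : ι → ι → ℝ)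
    (D : ι → ℝ → ℝ) (G : ι → ℝ × ℝ → (ι → ℝ) → (ι → ℝ) → ℝ) (f : ι → ℝ × ℝ → ℝ) : Prop :=
  ∃ fd f0 : ι → ℝ → ℝ, (∀ c, IsLinfUnit (fd c)) ∧ (∀ c, IsLinfUnit (f0 c)) ∧
    (∀ c, IsWeakTransportSolution a (b c) (f c)
      (fun p => G c p (fun c' => f c' p) (fun c' => fd c' p.1)) (fd c) (f0 c)) ∧
    (∀ c, b c < a → fd c =ᵐ[volume.restrict (Ioo 0 1)] D c) ∧
    (∀ c, 0 < b c → f0 c =ᵐ[volume.restrict (Ioo 0 1)] fun x => ∑ c', q c c' * f0 c' x)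

lemma dist_toLp_top_le {α : Type*} {mα : MeasurableSpace α} {ν : Measure α} [IsFiniteMeasure ν]
    {f f' : α → ℝ} (hf : MemLp f ⊤ ν) (hf' : MemLp f' ⊤ ν) {C : ℝ} (hC : 0 ≤ C)
    (h : ∀ᵐ x ∂ν, |f x - f' x| ≤ C) : dist (hf.toLp f) (hf'.toLp f') ≤ C := by
  rw [dist_eq_norm, ← MemLp.toLp_sub]
  refine (Lp.norm_le_of_ae_bound hC ?_).trans (by simp)
  filter_upwards [(hf.sub hf').coeFn_toLp, h] with x h1 h2
  rw [h1]
  exact h2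

lemma ae_abs_sub_le_dist_top {α : Type*} {mα : MeasurableSpace α} {ν : Measure α}
    (X Y : Lp ℝ ⊤ ν) : ∀ᵐ x ∂ν, |X x - Y x| ≤ dist X Y := by
  have h : ∀ᵐ x ∂ν, ‖(X - Y : Lp ℝ ⊤ ν) x‖ₑ ≤ eLpNorm (X - Y : Lp ℝ ⊤ ν) ⊤ ν := by
    rw [eLpNorm_exponent_top]; exact ae_le_eLpNormEssSup
  filter_upwards [h, Lp.coeFn_sub X Y] with x hx hs
  rw [hs] at hx
  rw [dist_eq_norm, Lp.norm_def, ← Real.norm_eq_abs, ← toReal_enorm]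
  exact ENNReal.toReal_mono (Lp.eLpNorm_ne_top _) hx

lemma continuous_exp_fst (M : ℝ) : Continuous fun p : ℝ × ℝ => Real.exp (M * p.1) := by fun_prop

lemma continuous_exp_mul (M : ℝ) : Continuous fun x : ℝ => Real.exp (M * x) := by fun_prop

section

variable {ι : Type*} [Fintype ι] {a : ℝ} {b : ι → ℝ} {q : ι → ι → ℝ} {D : ι → ℝ → ℝ}

/-- A system whose right-hand sides are Lipschitz continuous in the unknowns and in their diagonal
traces has exactly one weak solution. In terms of the unknowns multiplied by `exp (-M x)`, solving
the system with frozen right-hand sides is a contraction for large `M`, on families of functions on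
the triangle together with families of diagonal traces. -/
theorem existsUnique_isSemilinearSolution (ha : 0 < a) (hb : ∀ c, b c ≠ 0)
    (hq : ∀ c c', q c c' ≠ 0 → b c' < 0) (hD : ∀ c, IsLinfUnit (D c))
    {G : ι → ℝ × ℝ → (ι → ℝ) → (ι → ℝ) → ℝ}
    (hGm : ∀ (f : ι → ℝ × ℝ → ℝ) (fd : ι → ℝ → ℝ),
      (∀ c, MemLp (f c) ⊤ (volume.restrict triangle)) → (∀ c, IsLinfUnit (fd c)) →
      ∀ c, MemLp (fun p => G c p (fun c' => f c' p) (fun c' => fd c' p.1)) ⊤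
        (volume.restrict triangle))
    {Λ : ℝ} (hΛ : 0 ≤ Λ)
    (hGl : ∀ c, ∀ᵐ p ∂volume.restrict triangle, ∀ (u v u' v' : ι → ℝ) (δ : ℝ),
      (∀ c', |u c' - u' c'| ≤ δ) → (∀ c', |v c' - v' c'| ≤ δ) →
      |G c p u v - G c p u' v'| ≤ Λ * δ)
    (hGc : ∀ c p u v v', (∀ c', b c' ≠ a → v c' = v' c') → G c p u v = G c p u v') :
    ∃! f : ι → Lp ℝ ⊤ ((volume : Measure (ℝ × ℝ)).restrict triangle),
      IsSemilinearSolution a b q D G (fun c => f c) := by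
  set κ := (1 + ∑ c, ∑ c', |q c c'|) / a with hκ
  have hκ0 : 0 ≤ κ := by positivity
  -- the map below has Lipschitz constant `κ * Λ / M`
  set M := 2 * κ * Λ + 1 with hM
  have hM0 : 0 < M := by positivity
  let E := (ι → Lp ℝ ⊤ ((volume : Measure (ℝ × ℝ)).restrict triangle)) ×
    (ι → Lp ℝ ⊤ ((volume : Measure ℝ).restrict (Ioo 0 1)))
  let u : E → ι → ℝ × ℝ → ℝ := fun X c p => Real.exp (M * p.1) * X.1 c p
  let v : E → ι → ℝ → ℝ := fun X c x => Real.exp (M * x) * X.2 c x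
  have hu : ∀ X c, MemLp (u X c) ⊤ (volume.restrict triangle) := fun X c =>
    (continuous_exp_fst M).memLp_top_triangle.mul_top (Lp.memLp (X.1 c))
  have hv : ∀ X c, IsLinfUnit (v X c) := fun X c =>
    MemLp.mul_top (continuous_exp_mul M).isLinfUnit (Lp.memLp (X.2 c))
  let g : E → ι → ℝ × ℝ → ℝ := fun X c p => G c p (fun c' => u X c' p) (fun c' => v X c' p.1)
  have hg : ∀ X c, MemLp (g X c) ⊤ (volume.restrict triangle) := fun X c =>
    hGm (u X) (v X) (hu X) (hv X) c
  choose F Fd F0 hF using fun X => exists_isCoupledSolution ha hb hq hD (hg X)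
  have wT : ∀ {f : ℝ × ℝ → ℝ}, MemLp f ⊤ (volume.restrict triangle) →
      MemLp (fun p : ℝ × ℝ => Real.exp (-M * p.1) * f p) ⊤ (volume.restrict triangle) :=
    fun hf => (continuous_exp_fst (-M)).memLp_top_triangle.mul_top hf
  have wI : ∀ {h : ℝ → ℝ}, IsLinfUnit h →
      MemLp (fun x : ℝ => Real.exp (-M * x) * h x) ⊤ (volume.restrict (Ioo 0 1)) :=
    fun hh => MemLp.mul_top (continuous_exp_mul (-M)).isLinfUnit hh
  have cancel : ∀ x y : ℝ, Real.exp (M * x) * (Real.exp (-M * x) * y) = y := fun x y => by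
    rw [← mul_assoc, ← Real.exp_add]; simp
  let Φ : E → E := fun X => (fun c => (wT ((hF X).memLp c)).toLp _,
    fun c => (wI ((hF X).diag_linf c)).toLp _)
  have near : ∀ X Y : E, ∀ c, ∀ᵐ p ∂volume.restrict triangle,
      |g X c p - g Y c p| ≤ Λ * dist X Y * Real.exp (M * p.1) := by
    intro X Y c
    have h1 : ∀ᵐ p ∂volume.restrict triangle, ∀ c', |X.1 c' p - Y.1 c' p| ≤ dist X Y :=
      ae_all_iff.2 fun c' => (ae_abs_sub_le_dist_top (X.1 c') (Y.1 c')).mono fun p hp =>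
        hp.trans ((dist_le_pi_dist X.1 Y.1 c').trans (le_max_left _ _))
    have h2 : ∀ᵐ p ∂volume.restrict triangle, ∀ c', |X.2 c' p.1 - Y.2 c' p.1| ≤ dist X Y :=
      quasiMeasurePreserving_fst_triangle.ae (p := fun x => ∀ c', |X.2 c' x - Y.2 c' x| ≤ dist X Y)
        (ae_all_iff.2 fun c' => (ae_abs_sub_le_dist_top (X.2 c') (Y.2 c')).mono fun p hp =>
          hp.trans ((dist_le_pi_dist X.2 Y.2 c').trans (le_max_right _ _)))
    filter_upwards [hGl c, h1, h2] with p h3 h1 h2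
    rw [mul_assoc]
    have scale : ∀ s t : ℝ, |s - t| ≤ dist X Y →
        |Real.exp (M * p.1) * s - Real.exp (M * p.1) * t| ≤ dist X Y * Real.exp (M * p.1) := by
      intro s t h
      rw [← mul_sub, abs_mul, abs_of_pos (Real.exp_pos _), mul_comm]
      gcongr
    exact h3 _ _ _ _ _ (fun c' => scale _ _ (h1 c')) (fun c' => scale _ _ (h2 c'))
  have scaled : ∀ {x y z d : ℝ}, |y - z| ≤ d * Real.exp (M * x) →
      |Real.exp (-M * x) * y - Real.exp (-M * x) * z| ≤ d := by
    intro x y z d h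
    rw [← mul_sub, abs_mul, abs_of_pos (Real.exp_pos _)]
    calc Real.exp (-M * x) * |y - z| ≤ Real.exp (-M * x) * (d * Real.exp (M * x)) := by gcongr
      _ = d := by rw [mul_left_comm, ← Real.exp_add]; simp
  have contr : ContractingWith (1 / 2) Φ := by
    refine ⟨by norm_num, LipschitzWith.of_dist_le_mul fun X Y => ?_⟩
    have hd : 0 ≤ dist X Y := dist_nonneg
    have hle : κ * (Λ * dist X Y) / M ≤ 1 / 2 * dist X Y := by
      rw [div_le_iff₀ hM0, hM]
      nlinarith
    have est := (hF X).ae_dist_bound ha hb hq (hF Y) (hg X) (hg Y) hM0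
      (mul_nonneg hΛ hd) (near X Y)
    have hcast : ((1 / 2 : NNReal) : ℝ) = 1 / 2 := by norm_num
    rw [hcast]
    refine max_le ((dist_pi_le_iff (by positivity)).2 fun c => ?_)
      ((dist_pi_le_iff (by positivity)).2 fun c => ?_)
    · refine dist_toLp_top_le (wT ((hF X).memLp c)) (wT ((hF Y).memLp c)) (by positivity) ?_
      filter_upwards [(est c).1] with p hp
      exact (scaled hp).trans hle
    · refine dist_toLp_top_le (wI ((hF X).diag_linf c)) (wI ((hF Y).diag_linf c))
        (by positivity) ?_
      filter_upwards [(est c).2] with p hp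
      exact (scaled hp).trans hle
  -- every solution, with normalized traces, yields a fixed point
  have fixed : ∀ f : ι → Lp ℝ ⊤ ((volume : Measure (ℝ × ℝ)).restrict triangle),
      IsSemilinearSolution a b q D G (fun c => f c) →
      ∃ X, Φ X = X ∧ ∀ c, f c =ᵐ[volume.restrict triangle] u X c := by
    rintro f ⟨fd, f0, hfd, hf0, hw, hdD, hlow⟩
    classical
    set nd : ι → ℝ → ℝ := fun c => if b c = a then 0 else fd c with hnd
    have hndL : ∀ c, IsLinfUnit (nd c) := by
      intro c
      by_cases h : b c = a
      · simp only [hnd, h, if_true]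
        exact MemLp.zero
      · simpa [hnd, h] using hfd c
    let X : E := (fun c => (wT (Lp.memLp (f c))).toLp _, fun c => (wI (hndL c)).toLp _)
    have eu : ∀ c, f c =ᵐ[volume.restrict triangle] u X c := by
      intro c
      filter_upwards [(wT (Lp.memLp (f c))).coeFn_toLp] with p hp
      exact ((congrArg _ hp).trans (cancel _ _)).symm
    have ev : ∀ c, nd c =ᵐ[volume.restrict (Ioo 0 1)] v X c := by
      intro c
      filter_upwards [(wI (hndL c)).coeFn_toLp] with p hp
      exact ((congrArg _ hp).trans (cancel _ _)).symm
    have eg : ∀ c, (fun p => G c p (fun c' => f c' p) (fun c' => fd c' p.1))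
        =ᵐ[volume.restrict triangle] g X c := by
      intro c
      filter_upwards [ae_all_iff.2 eu, quasiMeasurePreserving_fst_triangle.ae
        (p := fun x => ∀ c, nd c x = v X c x) (ae_all_iff.2 ev)] with p h1 h2
      rw [hGc c p _ _ (fun c' => nd c' p.1) fun c' hc' => by simp [hnd, hc']]
      simp only [h1, h2]
      rfl
    have hsol : IsCoupledSolution a b q D (g X) (fun c => f c) nd f0 := by
      refine ⟨fun c => Lp.memLp _, hndL, hf0, fun c => (hw c).congr
        (Filter.EventuallyEq.refl _ _) (eg c) ?_ (Filter.EventuallyEq.refl _ _),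
        fun c hc => ?_, hlow, fun c hc => ?_⟩
      · by_cases h : b c = a
        · left; linarith
        · right; simp [hnd, h]
      · simpa [hnd, hc.ne] using hdD c hc
      · simp [hnd, hc]
    have same := (hF X).ae_dist_bound ha hb hq hsol (hg X) (hg X) hM0 le_rfl
      (fun c => Filter.Eventually.of_forall fun p => by simp)
    refine ⟨X, Prod.ext (funext fun c => ?_) (funext fun c => ?_), eu⟩
    · refine (MemLp.toLp_eq_toLp_iff (wT ((hF X).memLp c)) (wT (Lp.memLp (f c)))).2 ?_
      filter_upwards [(same c).1] with p hp
      rw [mul_zero, zero_div, zero_mul] at hp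
      rw [sub_eq_zero.1 (abs_nonpos_iff.1 hp)]
    · refine (MemLp.toLp_eq_toLp_iff (wI ((hF X).diag_linf c)) (wI (hndL c))).2 ?_
      filter_upwards [(same c).2] with p hp
      rw [mul_zero, zero_div, zero_mul] at hp
      rw [sub_eq_zero.1 (abs_nonpos_iff.1 hp)]
  refine existsUnique_of_exists_of_unique ?_ ?_
  · obtain ⟨X, hX⟩ : ∃ X, Φ X = X := ⟨_, contr.fixedPoint_isFixedPt⟩
    have eu : ∀ c, F X c =ᵐ[volume.restrict triangle] u X c := by
      intro c
      have h1 : (X.1 c : ℝ × ℝ → ℝ) =ᵐ[volume.restrict triangle]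
          fun p => Real.exp (-M * p.1) * F X c p := by
        have := (wT ((hF X).memLp c)).coeFn_toLp
        rwa [show (wT ((hF X).memLp c)).toLp _ = X.1 c from congrFun (congrArg Prod.fst hX) c]
          at this
      filter_upwards [h1] with p hp
      exact ((congrArg _ hp).trans (cancel _ _)).symm
    have ev : ∀ c, Fd X c =ᵐ[volume.restrict (Ioo 0 1)] v X c := by
      intro c
      have h1 : (X.2 c : ℝ → ℝ) =ᵐ[volume.restrict (Ioo 0 1)]
          fun x => Real.exp (-M * x) * Fd X c x := by
        have := (wI ((hF X).diag_linf c)).coeFn_toLp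
        rwa [show (wI ((hF X).diag_linf c)).toLp _ = X.2 c from congrFun (congrArg Prod.snd hX) c]
          at this
      filter_upwards [h1] with p hp
      exact ((congrArg _ hp).trans (cancel _ _)).symm
    have ef := fun c => ((hF X).memLp c).coeFn_toLp
    refine ⟨fun c => ((hF X).memLp c).toLp _, Fd X, F0 X, (hF X).diag_linf, (hF X).lower_linf,
      fun c => ((hF X).weak c).congr (ef c).symm ?_ (Or.inr (Filter.EventuallyEq.refl _ _))
        (Filter.EventuallyEq.refl _ _), (hF X).diag, (hF X).lower⟩
    filter_upwards [ae_all_iff.2 eu, ae_all_iff.2 ef, quasiMeasurePreserving_fst_triangle.ae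
      (p := fun x => ∀ c, Fd X c x = v X c x) (ae_all_iff.2 ev)] with p h1 h2 h3
    simp only [h2, h1, h3]
    rfl
  · intro f f' hf hf'
    obtain ⟨X, hX, hfX⟩ := fixed f hf
    obtain ⟨X', hX', hfX'⟩ := fixed f' hf'
    obtain rfl : X = X' := contr.fixedPoint_unique' hX hX'
    exact funext fun c => Lp.ext ((hfX c).trans (hfX' c).symm)

end

/-! ### The kernel system, row by row -/

/-- Conditions indexed by a well-ordered type, each of which determines one value in terms of the
values at larger indices, have exactly one common solution. -/
lemma existsUnique_of_triangular {I α : Type*} [LinearOrder I] [WellFoundedGT I] [Nonempty α]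
    {P : I → (I → α) → Prop} (hdep : ∀ i R R', (∀ k, i ≤ k → R k = R' k) → P i R → P i R')
    (h : ∀ i R, ∃! x, P i (Function.update R i x)) : ∃! R, ∀ i, P i R := by
  classical
  have wf : WellFounded ((· > ·) : I → I → Prop) := IsWellFounded.wf
  refine existsUnique_of_exists_of_unique ?_ fun R R' hR hR' => ?_
  · let step : ∀ i : I, (∀ k, k > i → α) → α := fun i rec =>
      (h i fun k => if hk : k > i then rec k hk else Classical.arbitrary α).choose
    refine ⟨wf.fix step, fun i => ?_⟩
    have hi := (h i fun k => if _ : k > i then wf.fix step k else Classical.arbitrary α).choose_spec.1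
    refine hdep i _ _ (fun k hk => ?_) hi
    rcases hk.eq_or_lt with rfl | hk
    · rw [Function.update_self, wf.fix_eq]
    · rw [Function.update_of_ne hk.ne', dif_pos hk]
  · funext i
    induction i using wf.induction with
    | _ i ih =>
      refine (h i R).unique ?_ ?_
      · rw [Function.update_eq_self]; exact hR i
      · refine hdep i _ _ (fun k hk => ?_) (hR' i)
        rcases hk.eq_or_lt with rfl | hk
        · rw [Function.update_self]
        · rw [Function.update_of_ne hk.ne', ih k hk]

namespace HyperbolicData

variable {n m : ℕ} (S : HyperbolicData n m)

/-- The speeds in the direction of `ξ` of the components of a row: `-lam j` for the entries of `K`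
and `mu j` for those of `L`. -/
def rowSpeed : Fin n ⊕ Fin m → ℝ := Sum.elim (fun j => -S.lam j) S.mu

/-- The coefficients that express the traces of `L i j` on the lower side through those of
`K i k`. -/
noncomputable def lowerCoupling (c c' : Fin n ⊕ Fin m) : ℝ :=
  Sum.elim (fun _ => 0)
    (fun j => Sum.elim (fun k => S.lam k * S.Q k j / S.mu j) (fun _ => 0) c') c

/-- The data of row `i` on the diagonal. -/
noncomputable def diagonalData (i : Fin m) : Fin n ⊕ Fin m → ℝ → ℝ :=
  Sum.elim (fun j _ => -S.Smp i j / (S.mu i + S.lam j))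
    (fun j _ => -S.Smm i j / (S.mu i - S.mu j))

/-- The right-hand side of row `i`, as a function of the values `u` of this row and of its diagonal
traces `v`. The other rows, of which only those below row `i` occur, are taken from `R`. -/
def rowRhs (i : Fin m) (R : Fin m → Fin n ⊕ Fin m → ℝ × ℝ → ℝ) (c : Fin n ⊕ Fin m) (p : ℝ × ℝ)
    (u v : Fin n ⊕ Fin m → ℝ) : ℝ :=
  ∑ c', Matrix.fromBlocks S.Spp S.Spm S.Smp S.Smm c' c * u c'
    - ∑ k ∈ Finset.Ici i, (if k = i then u c else R k c p)
        * ((S.mu i - S.mu k) * v (Sum.inr k) + S.Smm i k)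

/-- Row `i` of `R` solves its part of the kernel system. -/
def IsRowSolution (i : Fin m) (R : Fin m → Fin n ⊕ Fin m → ℝ × ℝ → ℝ) : Prop :=
  IsSemilinearSolution (S.mu i) S.rowSpeed S.lowerCoupling (S.diagonalData i) (S.rowRhs i R) (R i)

variable {S}

lemma rhsK_eq_rowRhs (R : Fin m → Fin n ⊕ Fin m → ℝ × ℝ → ℝ) (Ld : Fin m → Fin m → ℝ → ℝ)
    (i : Fin m) (j : Fin n) (v : Fin n ⊕ Fin m → ℝ) (p : ℝ × ℝ)
    (hv : ∀ k, v (Sum.inr k) = Ld i k p.1) :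
    S.rhsK (fun i j => R i (Sum.inl j)) (fun i j => R i (Sum.inr j)) (S.Omega Ld) i j p =
      S.rowRhs i R (Sum.inl j) p (fun c => R i c p) v := by
  simp only [rhsK, rowRhs, Fintype.sum_sum_type, Matrix.fromBlocks_apply₁₁,
    Matrix.fromBlocks_apply₂₁]
  congr 1
  refine Finset.sum_congr rfl fun k hk => ?_
  have h : (if k = i then R i (Sum.inl j) p else R k (Sum.inl j) p) = R k (Sum.inl j) p := by
    split_ifs with h
    · rw [h]
    · rfl
  rw [h, hv]
  simp [Omega, Finset.mem_Ici.1 hk]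

lemma rhsL_eq_rowRhs (R : Fin m → Fin n ⊕ Fin m → ℝ × ℝ → ℝ) (Ld : Fin m → Fin m → ℝ → ℝ)
    (i j : Fin m) (v : Fin n ⊕ Fin m → ℝ) (p : ℝ × ℝ)
    (hv : ∀ k, v (Sum.inr k) = Ld i k p.1) :
    S.rhsL (fun i j => R i (Sum.inl j)) (fun i j => R i (Sum.inr j)) (S.Omega Ld) i j p =
      S.rowRhs i R (Sum.inr j) p (fun c => R i c p) v := by
  simp only [rhsL, rowRhs, Fintype.sum_sum_type, Matrix.fromBlocks_apply₁₂,
    Matrix.fromBlocks_apply₂₂]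
  rw [add_comm (∑ k, S.Smm k j * R i (Sum.inr k) p)]
  congr 1
  refine Finset.sum_congr rfl fun k hk => ?_
  have h : (if k = i then R i (Sum.inr j) p else R k (Sum.inr j) p) = R k (Sum.inr j) p := by
    split_ifs with h
    · rw [h]
    · rfl
  rw [h, hv]
  simp [Omega, Finset.mem_Ici.1 hk]

lemma lowerCoupling_inr_iff (hmu_pos : ∀ i, 0 < S.mu i) (j : Fin m) (f0 : Fin n ⊕ Fin m → ℝ)
    (l : ℝ) : l = ∑ c', S.lowerCoupling (Sum.inr j) c' * f0 c' ↔
      S.mu j * l = ∑ k, S.lam k * f0 (Sum.inl k) * S.Q k j := by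
  have e : ∑ k, S.lam k * f0 (Sum.inl k) * S.Q k j =
      S.mu j * ∑ c', S.lowerCoupling (Sum.inr j) c' * f0 c' := by
    simp only [lowerCoupling, Fintype.sum_sum_type, Sum.elim_inr, Sum.elim_inl, zero_mul,
      Finset.sum_const_zero, add_zero, Finset.mul_sum]
    refine Finset.sum_congr rfl fun k _ => ?_
    have := (hmu_pos j).ne'
    field_simp
  rw [e, mul_right_inj' (hmu_pos j).ne']

/-- The kernel system is the conjunction of its rows, row `i` consisting of the entries `K i j` and
`L i j` of the two kernels. -/
lemma isKernelSolution_iff (hlam_pos : ∀ j, 0 < S.lam j) (hmu_pos : ∀ i, 0 < S.mu i)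
    (hmu_mono : StrictMono S.mu) (R : Fin m → Fin n ⊕ Fin m → ℝ × ℝ → ℝ) :
    S.IsKernelSolution (fun i j => R i (Sum.inl j)) (fun i j => R i (Sum.inr j)) ↔
      ∀ i, S.IsRowSolution i R := by
  constructor
  · rintro ⟨Kd, K0, Ld, L0, h⟩ i
    refine ⟨Sum.elim (Kd i) (Ld i), Sum.elim (K0 i) (L0 i), ?_, ?_, ?_, ?_, ?_⟩
    · rintro (j | j)
      exacts [h.Kd_linf i j, h.Ld_linf i j]
    · rintro (j | j)
      exacts [h.K0_linf i j, h.L0_linf i j]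
    · rintro (j | j)
      · exact (h.eqK i j).congr (.refl _ _)
          (.of_forall fun p => rhsK_eq_rowRhs R Ld i j _ p fun k => rfl) (.inr (.refl _ _))
          (.refl _ _)
      · exact (h.eqL i j).congr (.refl _ _)
          (.of_forall fun p => rhsL_eq_rowRhs R Ld i j _ p fun k => rfl) (.inr (.refl _ _))
          (.refl _ _)
    · rintro (j | j) hj
      exacts [h.diagK i j, h.diagL i j (hmu_mono.lt_iff_lt.1 hj)]
    · rintro (j | j) hj
      · exact absurd hj (by simpa [rowSpeed] using (hlam_pos j).le)
      · filter_upwards [h.lowerL i j] with x hx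
        exact (lowerCoupling_inr_iff hmu_pos j (fun c => Sum.elim (K0 i) (L0 i) c x) _).2 hx
  · intro h
    choose fd f0 hfd hf0 hw hd hl using h
    refine ⟨fun i j => fd i (Sum.inl j), fun i j => f0 i (Sum.inl j),
      fun i j => fd i (Sum.inr j), fun i j => f0 i (Sum.inr j), ?_⟩
    refine ⟨fun i j => hfd i _, fun i j => hf0 i _, fun i j => hfd i _, fun i j => hf0 i _,
      fun i j => ?_, fun i j => ?_, fun i j => ?_, fun i j hj => ?_, fun i j => ?_⟩
    · exact (hw i (Sum.inl j)).congr (.refl _ _)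
        (.of_forall fun p => (rhsK_eq_rowRhs R (fun i j => fd i (Sum.inr j)) i j
          (fun c => fd i c p.1) p fun k => rfl).symm) (.inr (.refl _ _)) (.refl _ _)
    · exact (hw i (Sum.inr j)).congr (.refl _ _)
        (.of_forall fun p => (rhsL_eq_rowRhs R (fun i j => fd i (Sum.inr j)) i j
          (fun c => fd i c p.1) p fun k => rfl).symm) (.inr (.refl _ _)) (.refl _ _)
    · exact hd i (Sum.inl j) (by simp only [rowSpeed, Sum.elim_inl]; linarith [hlam_pos j, hmu_pos i])
    · exact hd i (Sum.inr j) (hmu_mono hj)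
    · filter_upwards [hl i (Sum.inr j) (hmu_pos j)] with x hx
      exact (lowerCoupling_inr_iff hmu_pos j (fun c => f0 i c x) _).1 hx

lemma memLp_rowRhs {i : Fin m} {R : Fin m → Fin n ⊕ Fin m → ℝ × ℝ → ℝ}
    (hR : ∀ k c, MemLp (R k c) ⊤ (volume.restrict triangle))
    {f : Fin n ⊕ Fin m → ℝ × ℝ → ℝ} {fd : Fin n ⊕ Fin m → ℝ → ℝ}
    (hf : ∀ c, MemLp (f c) ⊤ (volume.restrict triangle)) (hfd : ∀ c, IsLinfUnit (fd c))
    (c : Fin n ⊕ Fin m) :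
    MemLp (fun p => S.rowRhs i R c p (fun c' => f c' p) (fun c' => fd c' p.1)) ⊤
      (volume.restrict triangle) := by
  unfold rowRhs
  refine MemLp.sub (memLp_finsetSum _ fun c' _ => (hf c').const_mul _)
    (memLp_finsetSum _ fun k _ => MemLp.mul_top ?_ ?_)
  · by_cases h : k = i
    · simpa [h] using hf c
    · simpa [h] using hR k c
  · exact ((hfd _).comp_fst.const_mul _).add (memLp_const _)

/-- In the product of the unknown row and its diagonal traces one factor is always known: either
the row comes from `R`, or the coefficient `mu i - mu k` vanishes. -/
lemma abs_rowRhs_sub_le {i : Fin m} {R : Fin m → Fin n ⊕ Fin m → ℝ × ℝ → ℝ} {p : ℝ × ℝ} {B : ℝ}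
    (hB : ∀ k c, |R k c p| ≤ B) (c : Fin n ⊕ Fin m) {u v u' v' : Fin n ⊕ Fin m → ℝ} {δ : ℝ}
    (hu : ∀ c', |u c' - u' c'| ≤ δ) (hv : ∀ c', |v c' - v' c'| ≤ δ) :
    |S.rowRhs i R c p u v - S.rowRhs i R c p u' v'| ≤
      (∑ c, ∑ c', |Matrix.fromBlocks S.Spp S.Spm S.Smp S.Smm c' c|
        + ∑ k, (B * |S.mu i - S.mu k| + |S.Smm i k|)) * δ := by
  set A := Matrix.fromBlocks S.Spp S.Spm S.Smp S.Smm
  have hδ : 0 ≤ δ := (abs_nonneg _).trans (hu c)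
  have hB0 : 0 ≤ B := (abs_nonneg _).trans (hB i c)
  have h1 : |∑ c', A c' c * u c' - ∑ c', A c' c * u' c'| ≤ (∑ c, ∑ c', |A c' c|) * δ := by
    rw [← Finset.sum_sub_distrib]
    calc |∑ c', (A c' c * u c' - A c' c * u' c')|
        ≤ ∑ c', |A c' c * u c' - A c' c * u' c'| := Finset.abs_sum_le_sum_abs _ _
      _ ≤ ∑ c', |A c' c| * δ := Finset.sum_le_sum fun c' _ => by
          rw [← mul_sub, abs_mul]
          exact mul_le_mul_of_nonneg_left (hu c') (abs_nonneg _)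
      _ = (∑ c', |A c' c|) * δ := (Finset.sum_mul _ _ _).symm
      _ ≤ _ := mul_le_mul_of_nonneg_right (Finset.single_le_sum (f := fun c => ∑ c', |A c' c|)
          (fun _ _ => by positivity) (Finset.mem_univ c)) hδ
  have h2 : |∑ k ∈ Finset.Ici i, (if k = i then u c else R k c p)
        * ((S.mu i - S.mu k) * v (Sum.inr k) + S.Smm i k)
      - ∑ k ∈ Finset.Ici i, (if k = i then u' c else R k c p)
        * ((S.mu i - S.mu k) * v' (Sum.inr k) + S.Smm i k)| ≤
      (∑ k, (B * |S.mu i - S.mu k| + |S.Smm i k|)) * δ := by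
    rw [← Finset.sum_sub_distrib, Finset.sum_mul]
    refine (Finset.abs_sum_le_sum_abs _ _).trans ((Finset.sum_le_sum fun k _ => ?_).trans
      (Finset.sum_le_sum_of_subset_of_nonneg (Finset.subset_univ _) fun k _ _ => by positivity))
    by_cases h : k = i
    · subst h
      simp only [if_true, sub_self, zero_mul, zero_add, abs_zero, mul_zero]
      rw [← sub_mul, abs_mul, mul_comm]
      exact mul_le_mul_of_nonneg_left (hu c) (abs_nonneg _)
    · simp only [h, if_false]
      rw [← mul_sub, add_sub_add_right_eq_sub, ← mul_sub, abs_mul, abs_mul, ← mul_assoc]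
      have := abs_nonneg (S.Smm i k)
      exact mul_le_mul ((mul_le_mul_of_nonneg_right (hB k c) (abs_nonneg _)).trans (by linarith))
        (hv _) (abs_nonneg _) (by positivity)
  rw [add_mul]
  unfold rowRhs
  rw [sub_sub_sub_comm]
  exact (abs_sub _ _).trans (add_le_add h1 h2)

/-- Traces on a characteristic diagonal do not enter the right-hand side. -/
lemma rowRhs_congr_trace {i : Fin m} (hmu_mono : StrictMono S.mu)
    (R : Fin m → Fin n ⊕ Fin m → ℝ × ℝ → ℝ) (c : Fin n ⊕ Fin m) (p : ℝ × ℝ)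
    (u v v' : Fin n ⊕ Fin m → ℝ) (h : ∀ c', S.rowSpeed c' ≠ S.mu i → v c' = v' c') :
    S.rowRhs i R c p u v = S.rowRhs i R c p u v' := by
  unfold rowRhs
  congr 1
  refine Finset.sum_congr rfl fun k _ => ?_
  by_cases hk : k = i
  · simp [hk]
  · rw [h (Sum.inr k) fun e => hk (hmu_mono.injective e)]

lemma rowRhs_congr_rows {i : Fin m} {R R' : Fin m → Fin n ⊕ Fin m → ℝ × ℝ → ℝ}
    (h : ∀ k, i < k → R k = R' k) : S.rowRhs i R = S.rowRhs i R' := by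
  funext c p u v
  unfold rowRhs
  congr 1
  refine Finset.sum_congr rfl fun k hk => ?_
  by_cases hki : k = i
  · simp [hki]
  · rw [h k (lt_of_le_of_ne (Finset.mem_Ici.1 hk) (Ne.symm hki))]

/-- Given the rows below it, row `i` of the kernel system is uniquely solvable. -/
lemma existsUnique_isRowSolution (hlam_pos : ∀ j, 0 < S.lam j) (hmu_pos : ∀ i, 0 < S.mu i)
    (hmu_mono : StrictMono S.mu) (i : Fin m)
    (R : Fin m → Fin n ⊕ Fin m → Lp ℝ ⊤ ((volume : Measure (ℝ × ℝ)).restrict triangle)) :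
    ∃! X, S.IsRowSolution i fun k c => Function.update R i X k c := by
  have hR : ∀ k c, MemLp (R k c) ⊤ (volume.restrict triangle) := fun k c => Lp.memLp _
  choose B hB0 hB using fun k c => (hR k c).exists_ae_bound
  have hB' : ∀ᵐ p ∂volume.restrict triangle, ∀ k c, |R k c p| ≤ ∑ k, ∑ c, B k c := by
    filter_upwards [ae_all_iff.2 fun k => ae_all_iff.2 (hB k)] with p hp k c
    refine (hp k c).trans ((Finset.single_le_sum (f := fun c => B k c) (fun c _ => hB0 k c)
      (Finset.mem_univ c)).trans ?_)
    exact Finset.single_le_sum (f := fun k => ∑ c, B k c)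
      (fun k _ => Finset.sum_nonneg fun c _ => hB0 k c) (Finset.mem_univ k)
  have hBs : 0 ≤ ∑ k, ∑ c, B k c :=
    Finset.sum_nonneg fun k _ => Finset.sum_nonneg fun c _ => hB0 k c
  have key := existsUnique_isSemilinearSolution (a := S.mu i) (b := S.rowSpeed)
    (q := S.lowerCoupling) (D := S.diagonalData i) (G := S.rowRhs i fun k c => R k c)
    (Λ := ∑ c, ∑ c', |Matrix.fromBlocks S.Spp S.Spm S.Smp S.Smm c' c|
        + ∑ k, ((∑ k, ∑ c, B k c) * |S.mu i - S.mu k| + |S.Smm i k|)) (hmu_pos i) ?_ ?_ ?_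
    (fun f fd hf hfd c => memLp_rowRhs hR hf hfd c) (by positivity)
    (fun c => hB'.mono fun p hp u v u' v' δ hu hv => abs_rowRhs_sub_le hp c hu hv)
    (fun c p u v v' h => rowRhs_congr_trace hmu_mono _ c p u v v' h)
  · convert key using 2 with X
    unfold IsRowSolution
    simp only [Function.update_self]
    rw [rowRhs_congr_rows (R' := fun k c => R k c)]
    intro k hk
    rw [Function.update_of_ne hk.ne']
  · rintro (j | j)
    exacts [neg_ne_zero.2 (hlam_pos j).ne', (hmu_pos j).ne']
  · rintro (j | j) (k | k) h
    · exact absurd rfl h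
    · exact absurd rfl h
    · exact neg_neg_of_pos (hlam_pos k)
    · exact absurd rfl h
  · rintro (j | j)
    exacts [memLp_const _, memLp_const _]

end HyperbolicData

theorem theorem1 (n m : ℕ) (S : HyperbolicData n m)
    (hlam_pos : ∀ j, 0 < S.lam j) (hlam_mono : Monotone S.lam)
    (hmu_pos : ∀ i, 0 < S.mu i) (hmu_mono : StrictMono S.mu) :
    ∃! KL : (Fin m → Fin n → Lp ℝ ⊤ (volume.restrict triangle)) ×
        (Fin m → Fin m → Lp ℝ ⊤ (volume.restrict triangle)),
      S.IsKernelSolution (fun i j => (KL.1 i j : ℝ × ℝ → ℝ))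
        (fun i j => (KL.2 i j : ℝ × ℝ → ℝ)) := by
  obtain ⟨R, hR, hu⟩ := existsUnique_of_triangular
    (P := fun i (R : Fin m → Fin n ⊕ Fin m → Lp ℝ ⊤ (volume.restrict triangle)) =>
      S.IsRowSolution i fun k c => R k c)
    (fun i R R' h hi => by
      unfold HyperbolicData.IsRowSolution at hi ⊢
      beta_reduce at hi ⊢
      rwa [← h i le_rfl, HyperbolicData.rowRhs_congr_rows (R' := fun k c => R k c)]
      intro k hk
      rw [h k hk.le])
    (fun i R => HyperbolicData.existsUnique_isRowSolution hlam_pos hmu_pos hmu_mono i R)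
  have iff := HyperbolicData.isKernelSolution_iff (S := S) hlam_pos hmu_pos hmu_mono
  refine ⟨(fun i j => R i (Sum.inl j), fun i j => R i (Sum.inr j)),
    (iff fun i c => R i c).2 hR, ?_⟩
  rintro ⟨K, L⟩ hKL
  have e := hu (fun i => Sum.elim (K i) (L i))
    ((iff fun i c => (Sum.elim (K i) (L i) c : Lp ℝ ⊤ (volume.restrict triangle))).1 hKL)
  rw [← e]
  rfl
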